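/- Let $q$ be a complex number with $|q|<1$, and write \[(a;q)_n=\prod_{s=0}^{n-1}(1-aq^s),\qquad (a;q)_\infty=\prod_{s=0}^{\infty}(1-aq^s),\qquad (a_1,\ldots,a_m;q)_\infty=(a_1;q)_\infty\cdots(a_m;q)_\infty .\] Let $j\in\{0,1\}$ and let $k,i$ be integers with $k\ge i\ge 2$ and $(2k+j)/2>2$. Then \[ \sum_{N_1\ge\cdots\ge N_{k-1}\ge0}\frac{q^{2(N_1^2+\cdots+N_{k-1}^2+N_i+\cdots+N_{k-1})}\,(-q^{1-2N_2};q^2)_{N_2}\,(-q^{1+2N_1};q^2)_\infty}{(q^2;q^2)_{N_1-N_2}\cdots(q^2;q^2)_{N_{k-2}-N_{k-1}}\,(q^{4-2j};q^{4-2j})_{N_{k-1}}} =\frac{(q^2;q^4)_\infty\,(q^{4k-2+2j},\,q^{2i-1},\,q^{4k-2i-1+2j};\,q^{4k-2+2j})_\infty}{(q;q)_\infty}, \] where the series on the left, over all integer tuples $(N_1,\ldots,N_{k-1})$ with $N_1\ge\cdots\ge N_{k-1}\ge 0$, converges absolutely. Here the linear sum $N_i+\cdots+N_{k-1}$ is $0$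 if $i=k$; if $k=2$, then $N_2$ is read as $0$ and the denominator is just $(q^{4-2j};q^{4-2j})_{N_1}$. For $q=0$ the summands are read as their limits for $q\to0$. -/

import Mathlib

namespace GollnitzGordon

/-- The finite `q`-shifted factorial `(a; q)_n = ∏_{s=0}^{n-1} (1 - a q^s)`. -/
noncomputable def qPoch (a q : ℂ) (n : ℕ) : ℂ :=
  ∏ s ∈ Finset.range n, (1 - a * q ^ s)

/-- The infinite `q`-shifted factorial `(a; q)_∞ = ∏_{s ≥ 0} (1 - a q^s)`. -/
noncomputable def qPochInf (a q : ℂ) : ℂ :=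
  ∏' s : ℕ, (1 - a * q ^ s)

/-- The infinite product `(a; q)_∞` converges whenever `|q| < 1`. -/
theorem multipliable_qPochInf (a : ℂ) {q : ℂ} (hq : ‖q‖ < 1) :
    Multipliable (fun s : ℕ => 1 - a * q ^ s) := by
  have h : Summable (fun s : ℕ => ‖-(a * q ^ s)‖) := by
    simp only [norm_neg, norm_mul, norm_pow]
    exact (summable_geometric_of_lt_one (norm_nonneg q) hq).mul_left _
  simpa [sub_eq_add_neg] using multipliable_one_add_of_summable h

/-- `(a₁, a₂, a₃; q)_∞ = (a₁; q)_∞ (a₂; q)_∞ (a₃; q)_∞`. -/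
noncomputable def qPochInf₃ (a₁ a₂ a₃ q : ℂ) : ℂ :=
  qPochInf a₁ q * qPochInf a₂ q * qPochInf a₃ q

/-- The summation range: the tuples `N_1 ≥ N_2 ≥ ⋯ ≥ N_{k-1} ≥ 0`. -/
abbrev Chain (k : ℕ) : Type := {N : Fin (k - 1) → ℕ // Antitone N}

/-- The entry `N_r` with 1-based index `r`, and `N_r = 0` if `r` is not in `1, …, k - 1`
(this only matters for `N_2` when `k = 2`). -/
def Chain.entry {k : ℕ} (N : Chain k) (r : ℕ) : ℕ :=
  if h : 1 ≤ r ∧ r ≤ k - 1 then N.1 ⟨r - 1, by omega⟩ else 0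

/-- The exponent `2 (N_1² + ⋯ + N_{k-1}² + N_i + ⋯ + N_{k-1})`. -/
def expo (k i : ℕ) (N : Chain k) : ℕ :=
  2 * (∑ r ∈ Finset.Icc 1 (k - 1), N.entry r ^ 2 + ∑ r ∈ Finset.Icc i (k - 1), N.entry r)

/-- The denominator
`(q²;q²)_{N_1-N_2} ⋯ (q²;q²)_{N_{k-2}-N_{k-1}} (q^{4-2j};q^{4-2j})_{N_{k-1}}`. -/
noncomputable def denom (k j : ℕ) (q : ℂ) (N : Chain k) : ℂ :=
  (∏ r ∈ Finset.Icc 1 (k - 2), qPoch (q ^ 2) (q ^ 2) (N.entry r - N.entry (r + 1))) *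
    qPoch (q ^ (4 - 2 * j)) (q ^ (4 - 2 * j)) (N.entry (k - 1))

/-- The summand of the multiple series. -/
noncomputable def summand (k i j : ℕ) (q : ℂ) (N : Chain k) : ℂ :=
  q ^ expo k i N *
      qPoch (-q ^ (1 - 2 * (N.entry 2 : ℤ))) (q ^ 2) (N.entry 2) *
      qPochInf (-q ^ (1 + 2 * N.entry 1)) (q ^ 2) /
    denom k j q N

end GollnitzGordon

/-!
The proof is an iteration of Bailey's lemma in base `Q = q²`. A Bailey pair relative to `1` or to
`Q` is encoded by a sequence `c : ℤ → ℂ` and the finite bilateral sums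
`V_n(c) = ∑_l c_l / ((Q)_{n-l} (Q)_{n+l})` and `U_n(c) = ∑_l c_l / ((Q)_{n-l} (Q)_{n+l+1})`
(`bilat Q n n c` and `bilat Q n (n + 1) c`).

* Summing over one variable multiplies the sequence by an explicit factor: `c_l` by `Q^{l²}` when
  `Q^{s²} V_s(c) / (Q)_{n-s}` is summed over `s`, and by `Q^{l²+l}` when
  `Q^{s²+s} U_s(c) / (Q)_{n-s}` is. With the additional finite parameter `-q`, which produces the
  factor `(-q; q²)_s` attached to `N_2`, the sequence is multiplied by `q^{l²}` only. All of this is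
  `sum_step_bilat`, which follows from a two-parameter `q`-Chu–Vandermonde sum
  (`sum_prod_mul_invPoch`).
* If `c` is antisymmetric about `-1/2`, then `Q^n U_n(c_l Q^{-l}) = V_n(c)` (`zpow_mul_bilat`). This
  passage takes place at `N_i`, where the linear part of the exponent ends.
* The innermost factor `1 / (q^{4-2j}; q^{4-2j})_n` is itself such a sum
  (`bilat_succ_eq_lastFactor`, `bilat_eq_lastFactor`), which also follows from the contiguity
  relations and from antisymmetry.

Hence the sum over `N_2, …, N_{k-1}` is `(-q; q²)_{N_1}` times a sum `V_{N_1}(c)` with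
`c_l = (-1)^l q^{quadratic in l}` (`hasSum_tailTerm_one`). The sum over `N_1` is the limit `n → ∞`
of one more step (`tsum_sq_mul_bilat`) and gives the theta series `∑_l (-1)^l q^{A l² + B l}` with
`A = 2k - 1 + j` and `B = 2k - 2i + j`. Jacobi's triple product (`tsum_eq_qPochInf_mul`) turns it
into the product on the right; it is obtained from its finite form, which is a closed form of the
same bilateral sums.
-/

namespace GollnitzGordon

open Filter Topology

/-! ### Reciprocal factorials and bilateral Bailey sums -/

/-- The reciprocal `1 / (Q; Q)_n` for an integer index `n`, with the usual convention that it
vanishes for `n < 0`. -/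
noncomputable def invPoch (Q : ℂ) (n : ℤ) : ℂ :=
  if 0 ≤ n then (qPoch Q Q n.toNat)⁻¹ else 0

lemma invPoch_of_neg (Q : ℂ) {n : ℤ} (hn : n < 0) : invPoch Q n = 0 := by
  simp [invPoch, hn]

lemma invPoch_natCast (Q : ℂ) (n : ℕ) : invPoch Q n = (qPoch Q Q n)⁻¹ := by
  simp [invPoch]

lemma invPoch_zero (Q : ℂ) : invPoch Q 0 = 1 := by
  simp [invPoch, qPoch]

lemma norm_sq_lt_one {q : ℂ} (hq : ‖q‖ < 1) : ‖q ^ 2‖ < 1 := by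
  rw [norm_pow]
  exact pow_lt_one₀ (norm_nonneg q) hq two_ne_zero

lemma pow_succ_ne_one {Q : ℂ} (hQ : ‖Q‖ < 1) (n : ℕ) : Q ^ (n + 1) ≠ 1 := by
  intro h
  have h1 : ‖Q‖ ^ (n + 1) = 1 := by rw [← norm_pow, h, norm_one]
  exact (pow_lt_one₀ (norm_nonneg Q) hQ n.succ_ne_zero).ne h1

lemma qPoch_succ (a Q : ℂ) (n : ℕ) : qPoch a Q (n + 1) = qPoch a Q n * (1 - a * Q ^ n) := by
  simp [qPoch, Finset.prod_range_succ]

lemma qPoch_succ' (a Q : ℂ) (n : ℕ) : qPoch a Q (n + 1) = (1 - a) * qPoch (a * Q) Q n := by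
  simp only [qPoch, Finset.prod_range_succ', pow_zero, mul_one, mul_comm (1 - a)]
  congr 1
  exact Finset.prod_congr rfl fun s _ => by ring

/-- The recurrence that holds for every integer `n`, in accordance with the convention for
negative indices. -/
lemma invPoch_sub_one {Q : ℂ} (hQ : ‖Q‖ < 1) (n : ℤ) :
    invPoch Q (n - 1) = (1 - Q ^ n) * invPoch Q n := by
  rcases lt_trichotomy n 0 with h | rfl | h
  · rw [invPoch_of_neg Q h, invPoch_of_neg Q (by omega), mul_zero]
  · simp [invPoch_of_neg]
  · obtain ⟨m, rfl⟩ : ∃ m : ℕ, n = (m : ℤ) + 1 := ⟨(n - 1).toNat, by omega⟩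
    have h1 : (1 : ℂ) - Q ^ (m + 1) ≠ 0 := sub_ne_zero.2 (pow_succ_ne_one hQ m).symm
    have h2 : ((m : ℤ) + 1) = ((m + 1 : ℕ) : ℤ) := by push_cast; ring
    rw [add_sub_cancel_right, h2, invPoch_natCast, invPoch_natCast, zpow_natCast, qPoch_succ,
      mul_inv, ← pow_succ']
    field_simp

/-- The bilateral sum `∑_l c_l / ((Q; Q)_{n-l} (Q; Q)_{m+l})`. For `m = n` and `m = n + 1` it is
the `β`-side of a Bailey pair relative to `1` and to `Q`, its `α`-side being spread over all
integers. The sum has only finitely many nonzero terms. -/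
noncomputable def bilat (Q : ℂ) (n m : ℤ) (c : ℤ → ℂ) : ℂ :=
  ∑' l : ℤ, c l * (invPoch Q (n - l) * invPoch Q (m + l))

lemma summable_bilat (Q : ℂ) (n m : ℤ) (c : ℤ → ℂ) :
    Summable fun l : ℤ => c l * (invPoch Q (n - l) * invPoch Q (m + l)) := by
  refine summable_of_hasFiniteSupport ((Set.finite_Icc (-m) n).subset fun l hl => ?_)
  rw [Function.mem_support] at hl
  by_contra h
  apply hl
  rw [Set.mem_Icc, not_and_or] at h
  rcases h with h | h
  · rw [invPoch_of_neg Q (n := m + l) (by omega)]; ring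
  · rw [invPoch_of_neg Q (n := n - l) (by omega)]; ring

lemma bilat_add (Q : ℂ) (n m : ℤ) (c d : ℤ → ℂ) :
    bilat Q n m (fun l => c l + d l) = bilat Q n m c + bilat Q n m d := by
  simp only [bilat, add_mul]
  exact (summable_bilat Q n m c).tsum_add (summable_bilat Q n m d)

lemma bilat_const_mul (Q : ℂ) (n m : ℤ) (a : ℂ) (c : ℤ → ℂ) :
    bilat Q n m (fun l => a * c l) = a * bilat Q n m c := by
  simp only [bilat, mul_assoc]
  exact tsum_mul_left

lemma bilat_shift (Q : ℂ) (n m : ℤ) (c : ℤ → ℂ) :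
    bilat Q (n - 1) (m + 1) (fun l => c (l + 1)) = bilat Q n m c := by
  unfold bilat
  rw [← (Equiv.addRight (1 : ℤ)).tsum_eq fun l => c l * (invPoch Q (n - l) * invPoch Q (m + l))]
  refine tsum_congr fun l => ?_
  simp only [Equiv.coe_addRight]
  rw [show n - 1 - l = n - (l + 1) by ring, show m + 1 + l = m + (l + 1) by ring]

lemma bilat_neg (Q : ℂ) (n m : ℤ) (c : ℤ → ℂ) :
    bilat Q n m (fun l => c (-l)) = bilat Q m n c := by
  unfold bilat
  rw [← (Equiv.neg ℤ).tsum_eq fun l => c l * (invPoch Q (m - l) * invPoch Q (n + l))]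
  refine tsum_congr fun l => ?_
  simp only [Equiv.neg_apply, sub_neg_eq_add, ← sub_eq_add_neg]
  ring

lemma bilat_reflect (Q : ℂ) (n : ℤ) (c : ℤ → ℂ) :
    bilat Q n (n + 1) (fun l => c (-1 - l)) = bilat Q n (n + 1) c := by
  have h := bilat_shift Q (n + 1) n fun l => c (-l)
  rw [bilat_neg, add_sub_cancel_right] at h
  rw [← h]
  congr 1
  funext l
  congr 1
  ring

lemma bilat_contiguous_right {Q : ℂ} (hQ : ‖Q‖ < 1) (n m : ℤ) (c : ℤ → ℂ) :
    bilat Q n (m - 1) c = bilat Q n m (fun l => c l * (1 - Q ^ (m + l))) := by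
  unfold bilat
  refine tsum_congr fun l => ?_
  rw [show m - 1 + l = m + l - 1 by ring, invPoch_sub_one hQ]
  ring

lemma bilat_contiguous_left {Q : ℂ} (hQ : ‖Q‖ < 1) (n m : ℤ) (c : ℤ → ℂ) :
    bilat Q (n - 1) m c = bilat Q n m (fun l => c l * (1 - Q ^ (n - l))) := by
  unfold bilat
  refine tsum_congr fun l => ?_
  rw [show n - 1 - l = n - l - 1 by ring, invPoch_sub_one hQ]
  ring

lemma bilat_eq_zero_of_antisymm (Q : ℂ) (n : ℤ) {c : ℤ → ℂ} (hc : ∀ l, c (-1 - l) = -c l) :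
    bilat Q n (n + 1) c = 0 := by
  have h := bilat_reflect Q n c
  simp only [hc, ← neg_one_mul (c _)] at h
  rw [bilat_const_mul] at h
  have h2 : (2 : ℂ) * bilat Q n (n + 1) c = 0 := by linear_combination -h
  simpa using h2

/-- The passage between Bailey pairs relative to `Q` and to `1`: it absorbs the factor `Q ^ n`,
provided that the sequence is antisymmetric about `-1/2`. -/
lemma zpow_mul_bilat {Q : ℂ} (hQ0 : Q ≠ 0) (hQ : ‖Q‖ < 1) (n : ℤ) {c : ℤ → ℂ}
    (hc : ∀ l, c (-1 - l) = -c l) :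
    Q ^ n * bilat Q n (n + 1) (fun l => c l * Q ^ (-l)) = bilat Q n n c := by
  have h1 := bilat_contiguous_right hQ n (n + 1) c
  rw [add_sub_cancel_right] at h1
  have h2 : bilat Q n (n + 1) (fun l => c l * Q ^ (-l)) =
      bilat Q n (n + 1) (fun l => -(c l * Q ^ (l + 1))) := by
    rw [← bilat_reflect]
    congr 1
    funext l
    rw [hc, show -(-1 - l) = l + 1 by ring, neg_mul]
  have h3 : (fun l => c l * (1 - Q ^ (n + 1 + l))) =
      fun l => c l + Q ^ n * -(c l * Q ^ (l + 1)) := by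
    funext l
    rw [show n + 1 + l = n + (l + 1) by ring, zpow_add₀ hQ0]
    ring
  rw [h1, h3, bilat_add, bilat_eq_zero_of_antisymm Q n hc, zero_add, bilat_const_mul, h2]

/-! ### Initial Bailey pairs -/

lemma neg_one_zpow_reflect (l : ℤ) : (-1 : ℂ) ^ (-1 - l) = -(-1) ^ l := by
  rw [show -1 - l = -(l + 1) by ring, zpow_neg, zpow_add₀ (by norm_num)]
  rcases Int.even_or_odd l with h | h
  · simp [h.neg_one_zpow]
  · simp [h.neg_one_zpow]

lemma bilat_zero_zero (Q : ℂ) (c : ℤ → ℂ) : bilat Q 0 0 c = c 0 := by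
  unfold bilat
  rw [tsum_eq_single 0]
  · simp [invPoch_zero]
  · intro l hl
    rcases lt_or_gt_of_ne hl with h | h
    · rw [invPoch_of_neg Q (n := 0 + l) (by omega)]; ring
    · rw [invPoch_of_neg Q (n := 0 - l) (by omega)]; ring

/-- If `c` becomes antisymmetric after multiplication by `Q ^ l`, then the sums relative to
`1` and to `Q` agree. -/
lemma bilat_eq_bilat_succ {Q : ℂ} (hQ0 : Q ≠ 0) (hQ : ‖Q‖ < 1) (n : ℤ) {c : ℤ → ℂ}
    (hc : ∀ l, c (-1 - l) * Q ^ (-1 - l) = -(c l * Q ^ l)) :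
    bilat Q n n c = bilat Q n (n + 1) c := by
  have h1 := bilat_contiguous_right hQ n (n + 1) c
  rw [add_sub_cancel_right] at h1
  have h3 : (fun l => c l * (1 - Q ^ (n + 1 + l))) =
      fun l => c l + -Q ^ (n + 1) * (c l * Q ^ l) := by
    funext l
    rw [zpow_add₀ hQ0]
    ring
  rw [h1, h3, bilat_add, bilat_const_mul,
    bilat_eq_zero_of_antisymm (c := fun l => c l * Q ^ l) Q n hc]
  ring

/-- The sequence `c` here is `(-1)^l Q^{l(l-1)/2}`, described by its symmetries: the associated
sums are `1` at `n = 0` and `0` afterwards (the unit Bailey pair). -/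
lemma bilat_unit {Q : ℂ} (hQ0 : Q ≠ 0) (hQ : ‖Q‖ < 1) {c : ℤ → ℂ} (hc0 : c 0 = 1)
    (hneg : ∀ l, c (-l) = c l * Q ^ l)
    (hc : ∀ l, c (-1 - l) * Q ^ (-1 - l) = -(c l * Q ^ l)) (n : ℕ) :
    bilat Q n n c = if n = 0 then 1 else 0 := by
  split_ifs with h
  · subst h
    rw [Nat.cast_zero, bilat_zero_zero, hc0]
  · have h1 := bilat_eq_bilat_succ hQ0 hQ n hc
    have h2 := zpow_mul_bilat (c := fun l => c l * Q ^ l) hQ0 hQ n hc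
    have h3 : (fun l => c l * Q ^ l * Q ^ (-l)) = c := by
      funext l
      rw [mul_assoc, ← zpow_add₀ hQ0, add_neg_cancel, zpow_zero, mul_one]
    -- Together with `h1` and `h2` this gives `(Q ^ n - 1) * bilat Q n n c = 0`.
    have h4 : bilat Q n n (fun l => c l * Q ^ l) = bilat Q n n c := by
      simp only [← hneg]
      exact bilat_neg Q n n c
    rw [h3, h4, ← h1] at h2
    obtain ⟨m, rfl⟩ := Nat.exists_eq_succ_of_ne_zero h
    have h5 : (Q ^ (m + 1) - 1) * bilat Q (m + 1 : ℕ) (m + 1 : ℕ) c = 0 := by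
      rw [Nat.succ_eq_add_one, zpow_natCast] at h2
      linear_combination h2
    exact (mul_eq_zero.1 h5).resolve_left (sub_ne_zero.2 (pow_succ_ne_one hQ m))

/-- The sequence `c` here is `(-1)^l Q^{l^2}`, described by its symmetries; the associated sums
are the reciprocals of `(Q^2; Q^2)_n`. -/
lemma bilat_square {Q : ℂ} (hQ0 : Q ≠ 0) (hQ : ‖Q‖ < 1) {c : ℤ → ℂ} (hc0 : c 0 = 1)
    (hneg : ∀ l, c (-l) = c l)
    (hc : ∀ l, c (-1 - l) * Q ^ (-1 - l) = -(c l * Q ^ l)) (n : ℕ) :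
    bilat Q n n c = (qPoch (Q ^ 2) (Q ^ 2) n)⁻¹ := by
  -- Contiguity from `n + 1` down to `n`, where the correction term is again expressed through
  -- `bilat Q (n + 1) (n + 1) c` by `zpow_mul_bilat`.
  have hrec (n : ℕ) : bilat Q n n c =
      (1 - Q ^ 2 * (Q ^ 2) ^ n) * bilat Q (n + 1 : ℕ) (n + 1 : ℕ) c := by
    have h1 := bilat_eq_bilat_succ hQ0 hQ n hc
    have h1' := bilat_eq_bilat_succ hQ0 hQ (n + 1 : ℕ) hc
    have h2 := zpow_mul_bilat (c := fun l => c l * Q ^ l) hQ0 hQ (n + 1 : ℕ) hc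
    have h3 : (fun l => c l * Q ^ l * Q ^ (-l)) = c := by
      funext l
      rw [mul_assoc, ← zpow_add₀ hQ0, add_neg_cancel, zpow_zero, mul_one]
    rw [h3, ← h1'] at h2
    have h4 := bilat_contiguous_left hQ ((n : ℤ) + 1) (n + 1) c
    rw [add_sub_cancel_right] at h4
    have h5 : (fun l => c l * (1 - Q ^ ((n : ℤ) + 1 - l))) =
        fun l => c l + -Q ^ ((n : ℤ) + 1) * (c (-l) * Q ^ (-l)) := by
      funext l
      rw [hneg, sub_eq_add_neg _ l, zpow_add₀ hQ0]
      ring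
    have h6 := bilat_neg Q ((n : ℤ) + 1) (n + 1) fun l => c l * Q ^ l
    rw [h1, h4, h5, bilat_add, bilat_const_mul, h6]
    push_cast at h2 ⊢
    rw [← h2, ← zpow_natCast (Q ^ 2), ← zpow_natCast Q 2, ← zpow_mul, ← zpow_add₀ hQ0,
      show ((2 : ℕ) : ℤ) + ((2 : ℕ) : ℤ) * n = (n + 1) + (n + 1) by push_cast; ring,
      zpow_add₀ hQ0 ((n : ℤ) + 1)]
    ring
  have hQ2 := norm_sq_lt_one hQ
  induction n with
  | zero => rw [Nat.cast_zero, bilat_zero_zero, hc0]; simp [qPoch]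
  | succ n ih =>
    have h := hrec n
    have h1 : 1 - Q ^ 2 * (Q ^ 2) ^ n ≠ 0 := by
      rw [← pow_succ']
      exact sub_ne_zero.2 (pow_succ_ne_one hQ2 n).symm
    rw [ih] at h
    rw [qPoch_succ, mul_inv, h]
    field_simp

/-! ### Summation formulas of Bailey lemma type -/

/-- A form of the `q`-Chu–Vandermonde sum with two free parameters, `Q ^ (b + 1)` and `y`. It
contains the terminating sum with `y = 0`. -/
lemma sum_prod_mul_invPoch {Q : ℂ} (hQ0 : Q ≠ 0) (hQ : ‖Q‖ < 1) (m : ℕ) (b : ℤ) (y : ℂ) :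
    ∑ t ∈ Finset.range (m + 1), (∏ s ∈ Finset.range t, (Q ^ (b + 1 + 2 * s) - y * Q ^ s)) *
      (invPoch Q t * invPoch Q ((m : ℤ) - t) * invPoch Q (t + b)) =
    qPoch y Q m * invPoch Q m * invPoch Q (m + b) := by
  induction m generalizing b y with
  | zero => simp [invPoch_zero, qPoch]
  | succ m ih =>
    set P : ℤ → ℂ → ℕ → ℂ :=
      fun b y t => ∏ s ∈ Finset.range t, (Q ^ (b + 1 + 2 * s) - y * Q ^ s) with hP
    have hP1 (t : ℕ) : P b y (t + 1) = P b y t * (Q ^ (b + 1 + 2 * t) - y * Q ^ t) := by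
      simp [hP, Finset.prod_range_succ]
    have hP2 (t : ℕ) : P (b + 1) (y * Q) t = Q ^ t * P b y t := by
      have hc : Q ^ t = ∏ _s ∈ Finset.range t, Q := by simp
      rw [hc, ← Finset.prod_mul_distrib]
      refine Finset.prod_congr rfl fun s _ => ?_
      rw [show b + 1 + 1 + 2 * (s : ℤ) = 1 + (b + 1 + 2 * s) by ring, zpow_add₀ hQ0, zpow_one]
      ring
    have key : (1 - Q ^ (m + 1)) * ∑ t ∈ Finset.range (m + 1 + 1), P b y t *
        (invPoch Q t * invPoch Q (((m + 1 : ℕ) : ℤ) - t) * invPoch Q (t + b)) =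
        (1 - y) * ∑ t ∈ Finset.range (m + 1), P (b + 1) (y * Q) t *
        (invPoch Q t * invPoch Q ((m : ℤ) - t) * invPoch Q (t + (b + 1))) := by
      -- `1 - Q^{m+1} = Q^t (1 - Q^{m+1-t}) + (1 - Q^t)` splits the sum in two. Shifting `t` in the
      -- second part recombines the parts, since `Q^{b+1+2t} - y Q^t` cancels against
      -- `Q^t (1 - Q^{t+b+1})` up to the factor `Q^t (1 - y)`.
      have e1 : (1 - Q ^ (m + 1)) * ∑ t ∈ Finset.range (m + 1 + 1), P b y t *
          (invPoch Q t * invPoch Q (((m + 1 : ℕ) : ℤ) - t) * invPoch Q (t + b)) =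
          ∑ t ∈ Finset.range (m + 1 + 1), (Q ^ t * P b y t *
            (invPoch Q t * invPoch Q ((m : ℤ) - t) * invPoch Q (t + b))) +
          ∑ t ∈ Finset.range (m + 1 + 1), (P b y t *
            (invPoch Q ((t : ℤ) - 1) * invPoch Q ((m : ℤ) + 1 - t) * invPoch Q (t + b))) := by
        rw [Finset.mul_sum, ← Finset.sum_add_distrib]
        refine Finset.sum_congr rfl fun t _ => ?_
        rw [show (m : ℤ) - t = m + 1 - t - 1 by ring, invPoch_sub_one hQ, invPoch_sub_one hQ,
          zpow_natCast, zpow_sub₀ hQ0, zpow_natCast]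
        have : Q ^ t ≠ 0 := pow_ne_zero _ hQ0
        push_cast
        rw [show Q ^ ((m : ℤ) + 1) = Q ^ (m + 1) by exact_mod_cast zpow_natCast Q (m + 1)]
        field_simp
        ring
      rw [e1, Finset.sum_range_succ, Finset.sum_range_succ' _ (m + 1),
        invPoch_of_neg Q (n := (m : ℤ) - ((m + 1 : ℕ) : ℤ)) (by push_cast; omega),
        invPoch_of_neg Q (n := ((0 : ℕ) : ℤ) - 1) (by simp)]
      simp only [mul_zero, zero_mul, add_zero]
      rw [← Finset.sum_add_distrib, Finset.mul_sum]
      refine Finset.sum_congr rfl fun t _ => ?_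
      rw [hP1, hP2, show (t : ℤ) + b = t + (b + 1) - 1 by ring, invPoch_sub_one hQ]
      push_cast
      rw [add_sub_cancel_right, show (m : ℤ) + 1 - (t + 1) = m - t by ring,
        show (t : ℤ) + 1 + b = t + (b + 1) by ring,
        show b + 1 + 2 * (t : ℤ) = t + (t + (b + 1)) by ring, zpow_add₀ hQ0 (t : ℤ) (t + (b + 1)),
        zpow_natCast]
      ring
    rw [ih] at key
    have h1 : (1 : ℂ) - Q ^ (m + 1) ≠ 0 := sub_ne_zero.2 (pow_succ_ne_one hQ m).symm
    have h2 : invPoch Q m = (1 - Q ^ (m + 1)) * invPoch Q ((m + 1 : ℕ) : ℤ) := by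
      rw [← zpow_natCast, ← invPoch_sub_one hQ]
      congr 1
      push_cast
      ring
    apply mul_left_cancel₀ h1
    rw [key, h2, qPoch_succ']
    push_cast
    rw [show (m : ℤ) + (b + 1) = m + 1 + b by ring]
    ring

/-- One step along the Bailey chain, for a single coefficient. The parameter `Y` is the finite
parameter of the step, and `θ` is the factor by which the step multiplies the `α`-side. -/
lemma sum_step_kernel {Q : ℂ} (hQ0 : Q ≠ 0) (hQ : ‖Q‖ < 1) {a : ℕ} (ha : a ≤ 1)
    {Y : ℂ} {θ : ℤ → ℂ}
    (hrec : ∀ s : ℕ, θ (s + 1) * (1 - Y * Q ^ s) = θ s * (Q ^ (2 * s + a + 1) - Y * Q ^ s))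
    (hsymm : ∀ l, θ (-a - l) = θ l) (n : ℕ) (l : ℤ) :
    ∑ s ∈ Finset.range (n + 1), qPoch Y Q s * θ s * invPoch Q ((n : ℤ) - s) *
      (invPoch Q ((s : ℤ) - l) * invPoch Q ((s : ℤ) + a + l)) =
    qPoch Y Q n * θ l * (invPoch Q ((n : ℤ) - l) * invPoch Q ((n : ℤ) + a + l)) := by
  have main (l : ℕ) : ∑ s ∈ Finset.range (n + 1), qPoch Y Q s * θ s * invPoch Q ((n : ℤ) - s) *
      (invPoch Q ((s : ℤ) - l) * invPoch Q ((s : ℤ) + a + l)) =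
      qPoch Y Q n * θ l * (invPoch Q ((n : ℤ) - l) * invPoch Q ((n : ℤ) + a + l)) := by
    rcases lt_or_ge n l with hnl | hnl
    · rw [invPoch_of_neg Q (n := (n : ℤ) - l) (by omega), zero_mul, mul_zero]
      refine Finset.sum_eq_zero fun s hs => ?_
      rw [Finset.mem_range] at hs
      rw [invPoch_of_neg Q (n := (s : ℤ) - l) (by omega)]
      ring
    · obtain ⟨m, rfl⟩ := Nat.exists_eq_add_of_le hnl
      rw [add_assoc, Finset.sum_range_add]
      have hzero : ∑ s ∈ Finset.range l, qPoch Y Q s * θ s * invPoch Q (((l + m : ℕ) : ℤ) - s) *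
          (invPoch Q ((s : ℤ) - l) * invPoch Q ((s : ℤ) + a + l)) = 0 := by
        refine Finset.sum_eq_zero fun s hs => ?_
        rw [Finset.mem_range] at hs
        rw [invPoch_of_neg Q (n := (s : ℤ) - l) (by omega)]
        ring
      have hweight (t : ℕ) : qPoch Y Q (l + t) * θ ((l + t : ℕ) : ℤ) = qPoch Y Q l * θ l *
          ∏ s ∈ Finset.range t, (Q ^ ((2 * l + a : ℤ) + 1 + 2 * s) - (Y * Q ^ l) * Q ^ s) := by
        induction t with
        | zero => simp
        | succ t ih =>
          rw [Finset.prod_range_succ, ← mul_assoc, ← ih, ← add_assoc, qPoch_succ]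
          have h := hrec (l + t)
          rw [show (2 * l + a : ℤ) + 1 + 2 * t = ((2 * (l + t) + a + 1 : ℕ) : ℤ) by
            push_cast; ring, zpow_natCast]
          push_cast at h ⊢
          rw [pow_add Q l t] at h ⊢
          linear_combination qPoch Y Q (l + t) * h
      have hpoch : qPoch Y Q (l + m) = qPoch Y Q l * qPoch (Y * Q ^ l) Q m := by
        simp only [qPoch, Finset.prod_range_add]
        congr 1
        exact Finset.prod_congr rfl fun s _ => by rw [pow_add]; ring
      rw [hzero, zero_add, hpoch]
      have hK := sum_prod_mul_invPoch hQ0 hQ m (2 * l + a) (Y * Q ^ l)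
      have e1 : ((l + m : ℕ) : ℤ) - l = m := by push_cast; ring
      have e2 : ((l + m : ℕ) : ℤ) + a + l = m + (2 * l + a) := by push_cast; ring
      rw [e1, e2]
      have hK' := congrArg (fun x => qPoch Y Q l * θ l * x) hK
      simp only [Finset.mul_sum] at hK'
      rw [show qPoch Y Q l * qPoch (Y * Q ^ l) Q m * θ l *
        (invPoch Q m * invPoch Q (m + (2 * l + a))) = qPoch Y Q l * θ l *
        (qPoch (Y * Q ^ l) Q m * invPoch Q m * invPoch Q (m + (2 * l + a))) by ring, ← hK']
      refine Finset.sum_congr rfl fun t _ => ?_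
      rw [hweight, show ((l + m : ℕ) : ℤ) - ((l + t : ℕ) : ℤ) = m - t by push_cast; ring,
        show ((l + t : ℕ) : ℤ) - l = t by push_cast; ring,
        show ((l + t : ℕ) : ℤ) + a + l = t + (2 * l + a) by push_cast; ring]
      ring
  rcases le_or_gt 0 l with h0 | h0
  · lift l to ℕ using h0
    exact main l
  · -- The reflection `l ↦ -a - l` exchanges the two reciprocal factorials.
    obtain ⟨l', hl'⟩ := Int.eq_ofNat_of_zero_le (show 0 ≤ -a - l by omega)
    obtain rfl : l = -a - l' := by omega
    have h := main l'
    rw [hsymm]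
    have e (s : ℤ) : invPoch Q (s - (-a - l')) * invPoch Q (s + a + (-a - l')) =
        invPoch Q (s - l') * invPoch Q (s + a + l') := by
      rw [show s - (-a - l') = s + a + l' by ring, show s + a + (-a - l') = s - l' by ring,
        mul_comm]
    simp only [e]
    exact h

/-- One step along the Bailey chain. The two admissible values `a = 0, 1` of the shift are the
chains relative to `1` and to `Q`. -/
lemma sum_step_bilat {Q : ℂ} (hQ0 : Q ≠ 0) (hQ : ‖Q‖ < 1) {a : ℕ} (ha : a ≤ 1)
    {Y : ℂ} {θ : ℤ → ℂ}
    (hrec : ∀ s : ℕ, θ (s + 1) * (1 - Y * Q ^ s) = θ s * (Q ^ (2 * s + a + 1) - Y * Q ^ s))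
    (hsymm : ∀ l, θ (-a - l) = θ l) (c : ℤ → ℂ) (n : ℕ) :
    ∑ s ∈ Finset.range (n + 1), qPoch Y Q s * θ s * invPoch Q ((n : ℤ) - s) *
      bilat Q s (s + a) c = qPoch Y Q n * bilat Q n (n + a) (fun l => c l * θ l) := by
  unfold bilat
  simp only [← tsum_mul_left]
  rw [← Summable.tsum_finsetSum fun (s : ℕ) _ => (summable_bilat Q s (s + a) c).mul_left _]
  refine tsum_congr fun l => ?_
  have h := sum_step_kernel hQ0 hQ ha hrec hsymm n l
  calc _ = c l * ∑ s ∈ Finset.range (n + 1), qPoch Y Q s * θ s * invPoch Q ((n : ℤ) - s) *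
      (invPoch Q ((s : ℤ) - l) * invPoch Q ((s : ℤ) + a + l)) := by
        rw [Finset.mul_sum]
        exact Finset.sum_congr rfl fun s _ => by ring
    _ = _ := by rw [h]; ring

/-- The series form of `sum_step_bilat`: the terms with `s > n` vanish. -/
lemma hasSum_step_bilat {Q : ℂ} (hQ0 : Q ≠ 0) (hQ : ‖Q‖ < 1) {a : ℕ} (ha : a ≤ 1)
    {Y : ℂ} {θ : ℤ → ℂ}
    (hrec : ∀ s : ℕ, θ (s + 1) * (1 - Y * Q ^ s) = θ s * (Q ^ (2 * s + a + 1) - Y * Q ^ s))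
    (hsymm : ∀ l, θ (-a - l) = θ l) (c : ℤ → ℂ) (n : ℕ) :
    HasSum (fun s : ℕ => qPoch Y Q s * θ s * invPoch Q ((n : ℤ) - s) * bilat Q s (s + a) c)
      (qPoch Y Q n * bilat Q n (n + a) (fun l => c l * θ l)) := by
  rw [← sum_step_bilat hQ0 hQ ha hrec hsymm]
  refine hasSum_sum_of_ne_finset_zero fun s hs => ?_
  rw [Finset.mem_range] at hs
  rw [invPoch_of_neg Q (n := (n : ℤ) - s) (by omega)]
  ring

lemma qPoch_zero_left (Q : ℂ) (n : ℕ) : qPoch 0 Q n = 1 := by simp [qPoch]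

/-- The step relative to `1` without finite parameter. -/
lemma hasSum_step_sq {Q : ℂ} (hQ0 : Q ≠ 0) (hQ : ‖Q‖ < 1) (c : ℤ → ℂ) (n : ℕ) :
    HasSum (fun s : ℕ => Q ^ (s ^ 2) * invPoch Q ((n : ℤ) - s) * bilat Q s s c)
      (bilat Q n n (fun l => c l * Q ^ (l ^ 2))) := by
  have h := hasSum_step_bilat hQ0 hQ (a := 0) (Y := 0) (θ := fun l => Q ^ (l ^ 2)) zero_le_one
    (fun s => ?_) (fun l => by simp) c n
  · simp only [qPoch_zero_left, one_mul, Nat.cast_zero, add_zero] at h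
    exact_mod_cast h
  · rw [show ((s : ℤ) + 1) ^ 2 = s ^ 2 + ((2 * s + 0 + 1 : ℕ) : ℤ) by push_cast; ring,
      zpow_add₀ hQ0, zpow_natCast]
    ring

/-- The step relative to `Q` without finite parameter. -/
lemma hasSum_step_sq_add {Q : ℂ} (hQ0 : Q ≠ 0) (hQ : ‖Q‖ < 1) (c : ℤ → ℂ) (n : ℕ) :
    HasSum (fun s : ℕ => Q ^ (s ^ 2 + s) * invPoch Q ((n : ℤ) - s) * bilat Q s (s + 1) c)
      (bilat Q n (n + 1) (fun l => c l * Q ^ (l ^ 2 + l))) := by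
  have h := hasSum_step_bilat hQ0 hQ (a := 1) (Y := 0) (θ := fun l => Q ^ (l ^ 2 + l)) le_rfl
    (fun s => ?_) (fun l => by congr 1; push_cast; ring) c n
  · simp only [qPoch_zero_left, one_mul, Nat.cast_one] at h
    exact_mod_cast h
  · rw [show ((s : ℤ) + 1) ^ 2 + (s + 1) = s ^ 2 + s + ((2 * s + 1 + 1 : ℕ) : ℤ) by
      push_cast; ring, zpow_add₀ hQ0, zpow_natCast]
    ring

/-- The step relative to `1` in base `q ^ 2` with finite parameter `-q`. -/
lemma hasSum_step_special {q : ℂ} (hq0 : q ≠ 0) (hq : ‖q ^ 2‖ < 1) (c : ℤ → ℂ) (n : ℕ) :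
    HasSum (fun s : ℕ => qPoch (-q) (q ^ 2) s * q ^ (s ^ 2) * invPoch (q ^ 2) ((n : ℤ) - s) *
      bilat (q ^ 2) s s c)
      (qPoch (-q) (q ^ 2) n * bilat (q ^ 2) n n (fun l => c l * q ^ (l ^ 2))) := by
  have h := hasSum_step_bilat (pow_ne_zero 2 hq0) hq (a := 0) (Y := -q)
    (θ := fun l => q ^ (l ^ 2)) zero_le_one (fun s => ?_) (fun l => by simp) c n
  · simp only [Nat.cast_zero, add_zero] at h
    exact_mod_cast h
  · rw [show ((s : ℤ) + 1) ^ 2 = s ^ 2 + ((2 * s + 1 : ℕ) : ℤ) by push_cast; ring,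
      zpow_add₀ hq0, zpow_natCast]
    ring

/-! ### Infinite products -/

lemma tendsto_qPoch (a : ℂ) {Q : ℂ} (hQ : ‖Q‖ < 1) :
    Tendsto (qPoch a Q) atTop (𝓝 (qPochInf a Q)) :=
  (multipliable_qPochInf a hQ).tendsto_prod_tprod_nat

lemma qPochInf_ne_zero {a Q : ℂ} (hQ : ‖Q‖ < 1) (h : ∀ s : ℕ, a * Q ^ s ≠ 1) :
    qPochInf a Q ≠ 0 := by
  have hs : Summable (fun s : ℕ => ‖-(a * Q ^ s)‖) := by
    simp only [norm_neg, norm_mul, norm_pow]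
    exact (summable_geometric_of_lt_one (norm_nonneg Q) hQ).mul_left _
  have := tprod_one_add_ne_zero_of_summable (f := fun s : ℕ => -(a * Q ^ s))
    (fun s => by rw [← sub_eq_add_neg]; exact sub_ne_zero.2 (h s).symm) hs
  simpa [qPochInf, sub_eq_add_neg] using this

lemma mul_pow_ne_one {a Q : ℂ} (ha : ‖a‖ < 1) (hQ : ‖Q‖ < 1) (s : ℕ) : a * Q ^ s ≠ 1 := by
  intro h
  have h1 : ‖a‖ * ‖Q‖ ^ s = 1 := by rw [← norm_pow, ← norm_mul, h, norm_one]
  have h2 := mul_le_of_le_one_right (norm_nonneg a) (pow_le_one₀ (norm_nonneg Q) hQ.le (n := s))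
  linarith

lemma qPochInf_ne_zero_of_norm_lt {a Q : ℂ} (ha : ‖a‖ < 1) (hQ : ‖Q‖ < 1) :
    qPochInf a Q ≠ 0 :=
  qPochInf_ne_zero hQ (mul_pow_ne_one ha hQ)

lemma qPoch_ne_zero_of_norm_lt {a Q : ℂ} (ha : ‖a‖ < 1) (hQ : ‖Q‖ < 1) (n : ℕ) :
    qPoch a Q n ≠ 0 :=
  Finset.prod_ne_zero_iff.2 fun s _ => sub_ne_zero.2 (mul_pow_ne_one ha hQ s).symm

lemma qPoch_mul_qPochInf (a : ℂ) {Q : ℂ} (hQ : ‖Q‖ < 1) (n : ℕ) :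
    qPoch a Q n * qPochInf (a * Q ^ n) Q = qPochInf a Q := by
  have h1 := (tendsto_qPoch (a * Q ^ n) hQ).const_mul (qPoch a Q n)
  have h2 := (tendsto_qPoch a hQ).comp (tendsto_add_atTop_nat n)
  refine tendsto_nhds_unique h1 (h2.congr fun m => ?_)
  simp only [Function.comp_apply, qPoch, add_comm m n, Finset.prod_range_add]
  congr 1
  exact Finset.prod_congr rfl fun s _ => by rw [pow_add]; ring

lemma qPochInf_mul_qPochInf_mul_self (a : ℂ) {Q : ℂ} (hQ : ‖Q‖ < 1) :
    qPochInf a (Q ^ 2) * qPochInf (a * Q) (Q ^ 2) = qPochInf a Q := by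
  have hQ2 := norm_sq_lt_one hQ
  have h1 := (tendsto_qPoch a hQ2).mul (tendsto_qPoch (a * Q) hQ2)
  have h2 := (tendsto_qPoch a hQ).comp (tendsto_id.const_mul_atTop' (two_pos : (0 : ℕ) < 2))
  refine tendsto_nhds_unique h1 (h2.congr fun m => ?_)
  simp only [Function.comp_apply, id]
  induction m with
  | zero => simp [qPoch]
  | succ m ih =>
    rw [mul_add_one, show 2 * m + 2 = 2 * m + 1 + 1 by ring, qPoch_succ, qPoch_succ, ih,
      qPoch_succ, qPoch_succ, ← pow_mul]
    ring

lemma qPochInf_mul_qPochInf_neg (a : ℂ) {Q : ℂ} (hQ : ‖Q‖ < 1) :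
    qPochInf a Q * qPochInf (-a) Q = qPochInf (a ^ 2) (Q ^ 2) := by
  have hQ2 := norm_sq_lt_one hQ
  refine tendsto_nhds_unique ((tendsto_qPoch a hQ).mul (tendsto_qPoch (-a) hQ))
    ((tendsto_qPoch (a ^ 2) hQ2).congr fun m => ?_)
  rw [qPoch, qPoch, qPoch, ← Finset.prod_mul_distrib]
  exact Finset.prod_congr rfl fun s _ => by ring

lemma exists_norm_qPoch_le (a : ℂ) {Q : ℂ} (hQ : ‖Q‖ < 1) : ∃ C, ∀ n, ‖qPoch a Q n‖ ≤ C := by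
  obtain ⟨C, hC⟩ := (Metric.isBounded_range_of_tendsto _ (tendsto_qPoch a hQ)).exists_norm_le
  exact ⟨C, fun n => hC _ ⟨n, rfl⟩⟩

lemma exists_norm_inv_qPoch_le {a Q : ℂ} (ha : ‖a‖ < 1) (hQ : ‖Q‖ < 1) :
    ∃ C, ∀ n, ‖(qPoch a Q n)⁻¹‖ ≤ C := by
  obtain ⟨C, hC⟩ := (Metric.isBounded_range_of_tendsto _
    ((tendsto_qPoch a hQ).inv₀ (qPochInf_ne_zero_of_norm_lt ha hQ))).exists_norm_le
  exact ⟨C, fun n => hC _ ⟨n, rfl⟩⟩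

lemma exists_norm_invPoch_le {Q : ℂ} (hQ : ‖Q‖ < 1) : ∃ C, 0 ≤ C ∧ ∀ n, ‖invPoch Q n‖ ≤ C := by
  obtain ⟨C, hC⟩ := exists_norm_inv_qPoch_le hQ hQ
  have h0 : 0 ≤ C := (norm_nonneg _).trans (hC 0)
  refine ⟨C, h0, fun n => ?_⟩
  unfold invPoch
  split_ifs
  · exact hC _
  · simpa using h0

lemma tendsto_invPoch {Q : ℂ} (hQ : ‖Q‖ < 1) :
    Tendsto (invPoch Q) atTop (𝓝 (qPochInf Q Q)⁻¹) := by
  rw [← Nat.map_cast_int_atTop, tendsto_map'_iff]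
  exact ((tendsto_qPoch Q hQ).inv₀ (qPochInf_ne_zero_of_norm_lt hQ hQ)).congr fun n =>
    (invPoch_natCast Q n).symm

/-! ### Limits of the bilateral sums and the Jacobi triple product -/

lemma norm_bilat_term_le {Q : ℂ} {C : ℝ} (hC0 : 0 ≤ C) (hC : ∀ n, ‖invPoch Q n‖ ≤ C)
    (n m : ℤ) (c : ℤ → ℂ) (l : ℤ) :
    ‖c l * (invPoch Q (n - l) * invPoch Q (m + l))‖ ≤ ‖c l‖ * (C * C) := by
  rw [norm_mul, norm_mul]
  gcongr
  · exact hC _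
  · exact hC _

lemma tendsto_bilat {Q : ℂ} (hQ : ‖Q‖ < 1) {c : ℤ → ℂ} (hc : Summable fun l => ‖c l‖) :
    Tendsto (fun n : ℕ => bilat Q n n c) atTop
      (𝓝 ((∑' l, c l) * ((qPochInf Q Q)⁻¹ * (qPochInf Q Q)⁻¹))) := by
  obtain ⟨C, hC0, hC⟩ := exists_norm_invPoch_le hQ
  rw [← tsum_mul_right]
  refine tendsto_tsum_of_dominated_convergence (hc.mul_right (C * C)) (fun l => ?_)
    (Eventually.of_forall fun n l => norm_bilat_term_le hC0 hC n n c l)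
  refine Tendsto.const_mul _ (Tendsto.mul ?_ ?_)
  · exact (tendsto_invPoch hQ).comp
      (tendsto_atTop_add_const_right _ (-l) tendsto_natCast_atTop_atTop)
  · exact (tendsto_invPoch hQ).comp (tendsto_atTop_add_const_right _ l tendsto_natCast_atTop_atTop)

/-- The last step along the Bailey chain, with `n → ∞` in `hasSum_step_sq`. -/
lemma tsum_sq_mul_bilat {Q : ℂ} (hQ0 : Q ≠ 0) (hQ : ‖Q‖ < 1) {c : ℤ → ℂ}
    (hc : Summable fun l => ‖c l‖) (hc' : Summable fun l => ‖c l * Q ^ (l ^ 2)‖) :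
    ∑' s : ℕ, Q ^ (s ^ 2) * bilat Q s s c =
      (∑' l : ℤ, c l * Q ^ (l ^ 2)) * (qPochInf Q Q)⁻¹ := by
  obtain ⟨C, hC0, hC⟩ := exists_norm_invPoch_le hQ
  have hbil (s : ℕ) : ‖bilat Q s s c‖ ≤ ∑' l, ‖c l‖ * (C * C) :=
    tsum_of_norm_bounded (hc.mul_right (C * C)).hasSum fun l => norm_bilat_term_le hC0 hC _ _ c l
  have h1 : Tendsto (fun n : ℕ => ∑' s : ℕ, Q ^ (s ^ 2) * invPoch Q ((n : ℤ) - s) * bilat Q s s c)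
      atTop (𝓝 (∑' s : ℕ, Q ^ (s ^ 2) * (qPochInf Q Q)⁻¹ * bilat Q s s c)) := by
    refine tendsto_tsum_of_dominated_convergence
      (bound := fun s : ℕ => ‖Q‖ ^ s * C * ∑' l, ‖c l‖ * (C * C))
      (((summable_geometric_of_lt_one (norm_nonneg Q) hQ).mul_right _).mul_right _) (fun s => ?_)
      (Eventually.of_forall fun n s => ?_)
    · refine Tendsto.mul_const _ (Tendsto.const_mul _ ?_)
      exact (tendsto_invPoch hQ).comp
        (tendsto_atTop_add_const_right _ (-(s : ℤ)) tendsto_natCast_atTop_atTop)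
    · rw [norm_mul, norm_mul, norm_pow]
      have h3 : ‖Q‖ ^ (s ^ 2) ≤ ‖Q‖ ^ s :=
        pow_le_pow_of_le_one (norm_nonneg Q) hQ.le (Nat.le_self_pow two_ne_zero s)
      gcongr
      · exact hC _
      · exact hbil s
  simp only [(hasSum_step_sq hQ0 hQ c _).tsum_eq] at h1
  have h2 := tendsto_nhds_unique h1 (tendsto_bilat hQ hc')
  have h3 : ∑' s : ℕ, Q ^ (s ^ 2) * (qPochInf Q Q)⁻¹ * bilat Q s s c =
      (∑' s : ℕ, Q ^ (s ^ 2) * bilat Q s s c) * (qPochInf Q Q)⁻¹ := by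
    rw [← tsum_mul_right]
    exact tsum_congr fun s => by ring
  rw [h3, ← mul_assoc] at h2
  exact mul_right_cancel₀ (inv_ne_zero (qPochInf_ne_zero_of_norm_lt hQ hQ)) h2

/-- One induction step for the finite Jacobi triple product. -/
lemma bilat_succ_right_of_rec {Q z : ℂ} (hQ0 : Q ≠ 0) (hQ : ‖Q‖ < 1) (hz : z ≠ 0) {c : ℤ → ℂ}
    (hc : ∀ l, c (l + 1) = -(z * Q ^ l) * c l) (n m : ℤ) :
    (1 - Q ^ (n + m + 1)) * bilat Q n (m + 1) c = (1 - Q / z * Q ^ m) * bilat Q n m c := by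
  have h1 := bilat_contiguous_right hQ n (m + 1) c
  rw [add_sub_cancel_right] at h1
  have h2 := bilat_contiguous_left hQ n (m + 1) fun l => c (l + 1)
  rw [bilat_shift] at h2
  have h3 : (fun l => (1 - Q ^ (n + m + 1)) * c l) = fun l => c l * (1 - Q ^ (m + 1 + l)) +
      -(Q / z * Q ^ m) * (c (l + 1) * (1 - Q ^ (n - l))) := by
    funext l
    rw [hc]
    have e1 : Q ^ (n + m + 1) = Q ^ (m + 1 + l) * Q ^ (n - l) := by
      rw [← zpow_add₀ hQ0]
      congr 1
      ring
    have e2 : Q ^ (m + 1 + l) = Q * Q ^ m * Q ^ l := by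
      rw [zpow_add₀ hQ0, zpow_add₀ hQ0, zpow_one]
      ring
    rw [e1, e2]
    field_simp
    ring
  rw [← bilat_const_mul, h3, bilat_add, bilat_const_mul, ← h1, ← h2]
  ring

/-- The finite Jacobi triple product. The hypotheses on `c` say that
`c l = (-1)^l z^l Q^{l(l-1)/2}`. -/
lemma bilat_eq_qPoch_mul {Q z : ℂ} (hQ0 : Q ≠ 0) (hQ : ‖Q‖ < 1) (hz : z ≠ 0) {c : ℤ → ℂ}
    (hc0 : c 0 = 1) (hc : ∀ l, c (l + 1) = -(z * Q ^ l) * c l) (n m : ℕ) :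
    bilat Q n m c = qPoch z Q n * qPoch (Q / z) Q m * invPoch Q ((n + m : ℕ) : ℤ) := by
  have hinv (N : ℕ) : invPoch Q N = (1 - Q ^ (N + 1)) * invPoch Q ((N + 1 : ℕ) : ℤ) := by
    rw [← zpow_natCast, ← invPoch_sub_one hQ]
    congr 1
    push_cast
    ring
  have hc' (l : ℤ) : c (-(l + 1)) = -(Q / z * Q ^ l) * c (-l) := by
    have h := hc (-(l + 1))
    rw [show -(l + 1) + 1 = -l by ring, zpow_neg, zpow_add₀ hQ0, zpow_one] at h
    have : Q ^ l ≠ 0 := zpow_ne_zero _ hQ0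
    rw [h]
    field_simp
  induction m with
  | zero =>
    induction n with
    | zero => rw [Nat.cast_zero, bilat_zero_zero, hc0]; simp [qPoch, invPoch_zero]
    | succ n ih =>
      have h := bilat_succ_right_of_rec hQ0 hQ (c := fun l => c (-l))
        (div_ne_zero hQ0 hz) hc' 0 n
      rw [bilat_neg, bilat_neg, div_div_cancel₀ hQ0, zero_add] at h
      have h1 : (1 : ℂ) - Q ^ (n + 1) ≠ 0 := sub_ne_zero.2 (pow_succ_ne_one hQ n).symm
      have hi := hinv n
      apply mul_left_cancel₀ h1
      simp only [add_zero, Nat.cast_zero, zpow_natCast, qPoch_succ] at ih h ⊢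
      rw [show Q ^ ((n : ℤ) + 1) = Q ^ (n + 1) by exact_mod_cast zpow_natCast Q (n + 1)] at h
      push_cast at hi ⊢
      rw [h, ih, hi]
      ring
  | succ m ih =>
    have h := bilat_succ_right_of_rec hQ0 hQ hz hc n m
    have h1 : (1 : ℂ) - Q ^ (n + m + 1) ≠ 0 := sub_ne_zero.2 (pow_succ_ne_one hQ _).symm
    have hi := hinv (n + m)
    apply mul_left_cancel₀ h1
    rw [show Q ^ ((n : ℤ) + m + 1) = Q ^ (n + m + 1) by
      exact_mod_cast zpow_natCast Q (n + m + 1), ih, zpow_natCast, hi] at h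
    rw [qPoch_succ]
    push_cast at h ⊢
    rw [← add_assoc, h]
    ring

/-- The Jacobi triple product identity. -/
lemma tsum_eq_qPochInf_mul {Q z : ℂ} (hQ0 : Q ≠ 0) (hQ : ‖Q‖ < 1) (hz : z ≠ 0) {c : ℤ → ℂ}
    (hc0 : c 0 = 1) (hc : ∀ l, c (l + 1) = -(z * Q ^ l) * c l) (hs : Summable fun l => ‖c l‖) :
    ∑' l, c l = qPochInf Q Q * qPochInf z Q * qPochInf (Q / z) Q := by
  have h1 := tendsto_bilat hQ hs
  simp only [bilat_eq_qPoch_mul hQ0 hQ hz hc0 hc] at h1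
  have h2 := ((tendsto_qPoch z hQ).mul (tendsto_qPoch (Q / z) hQ)).mul
    ((tendsto_invPoch hQ).comp (tendsto_natCast_atTop_atTop.comp
      (tendsto_id.atTop_add_atTop (tendsto_id : Tendsto id atTop (atTop : Filter ℕ)))))
  have h3 := tendsto_nhds_unique h1 h2
  have h4 := qPochInf_ne_zero_of_norm_lt hQ hQ
  field_simp at h3
  rw [h3]

lemma summable_norm_zpow_quadratic {q : ℂ} (hq0 : q ≠ 0) (hq : ‖q‖ < 1) {A : ℤ} (hA : 0 < A)
    (B : ℤ) : Summable fun l : ℤ => ‖q ^ (A * l ^ 2 + B * l)‖ := by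
  have h0 : 0 < ‖q‖ := norm_pos_iff.2 hq0
  have hgeom : Summable fun l : ℤ => ‖q‖ ^ l.natAbs := by
    refine Summable.of_nat_of_neg ?_ ?_ <;>
    simpa using summable_geometric_of_lt_one (norm_nonneg q) hq
  refine Summable.of_nonneg_of_le (fun l => norm_nonneg _) (fun l => ?_)
    (hgeom.mul_left (‖q‖ ^ (-(|B| + 1) ^ 2)))
  rw [norm_zpow, ← zpow_natCast, ← zpow_add₀ h0.ne']
  refine zpow_le_zpow_right_of_le_one₀ h0 hq.le ?_
  rw [Int.natCast_natAbs]
  have h1 : -(|B| * |l|) ≤ B * l := by rw [← abs_mul]; exact neg_abs_le _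
  have h2 : |l| ^ 2 = l ^ 2 := sq_abs l
  nlinarith [sq_nonneg (2 * |l| - (|B| + 1)), sq_nonneg (|B| + 1), sq_nonneg l, abs_nonneg l,
    abs_nonneg B]

/-! ### Evaluation of the multiple sum -/

/-- The factor of the summand that depends on `N_r` alone, for `r ≥ 2`. -/
noncomputable def stepWeight (q : ℂ) (i r s : ℕ) : ℂ :=
  (q ^ 2) ^ (s ^ 2 + if i ≤ r then s else 0) *
    if r = 2 then qPoch (-q ^ (1 - 2 * (s : ℤ))) (q ^ 2) s else 1

/-- The part of the summand that involves the last `m + 1` variables `N_r ≥ ⋯ ≥ N_{r+m}`, without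
the factor depending on `N_r` alone. Here `b` is the factor depending on the last variable, and
the variables are numbered from `0`. The reciprocal factorials make it vanish unless `N` is
antitone. -/
noncomputable def tailTerm (q : ℂ) (i : ℕ) (b : ℕ → ℂ) (m r : ℕ) (N : Fin (m + 1) → ℕ) : ℂ :=
  (∏ t : Fin m, stepWeight q i (r + 1 + t) (N t.succ) *
    invPoch (q ^ 2) ((N t.castSucc : ℤ) - N t.succ)) * b (N (Fin.last m))

lemma tailTerm_zero (q : ℂ) (i : ℕ) (b : ℕ → ℂ) (r : ℕ) (N : Fin 1 → ℕ) :
    tailTerm q i b 0 r N = b (N 0) := by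
  simp [tailTerm]

lemma tailTerm_cons_cons (q : ℂ) (i : ℕ) (b : ℕ → ℂ) (m r n s : ℕ) (N : Fin m → ℕ) :
    tailTerm q i b (m + 1) r (Fin.cons n (Fin.cons s N : Fin (m + 1) → ℕ)) =
      stepWeight q i (r + 1) s * invPoch (q ^ 2) ((n : ℤ) - s) *
        tailTerm q i b m (r + 1) (Fin.cons s N) := by
  simp only [tailTerm]
  rw [Fin.prod_univ_succ, ← Fin.succ_last, Fin.cons_succ]
  simp only [Fin.cons_succ, Fin.castSucc_zero, Fin.cons_zero, Fin.val_zero, add_zero,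
    ← Fin.succ_castSucc, Fin.val_succ]
  simp only [mul_assoc, add_comm, add_left_comm]

/-- Reversing the order of the factors shows that the negative powers in the `N_2`-factor of the
summand amount to `q ^ (-N_2²)`. -/
lemma pow_sq_mul_qPoch_reverse {q : ℂ} (hq0 : q ≠ 0) (s : ℕ) :
    q ^ (s ^ 2) * qPoch (-q ^ (1 - 2 * (s : ℤ))) (q ^ 2) s = qPoch (-q) (q ^ 2) s := by
  have h1 : q ^ (s ^ 2) = ∏ u ∈ Finset.range s, q ^ (2 * u + 1) := by
    induction s with
    | zero => simp
    | succ s ih => rw [Finset.prod_range_succ, ← ih, ← pow_add]; congr 1; ring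
  rw [qPoch, ← Finset.prod_range_reflect, h1, ← Finset.prod_mul_distrib, qPoch]
  refine Finset.prod_congr rfl fun u hu => ?_
  rw [Finset.mem_range] at hu
  have h2 : q ^ (1 - 2 * (s : ℤ)) * (q ^ 2) ^ (s - 1 - u) = (q ^ (2 * u + 1))⁻¹ := by
    rw [← pow_mul, ← zpow_natCast, ← zpow_natCast, ← zpow_add₀ hq0, ← zpow_neg]
    congr 1
    push_cast [Nat.sub_sub, Nat.cast_sub (show 1 + u ≤ s by omega)]
    ring
  have h3 : q ^ (2 * u + 1) ≠ 0 := pow_ne_zero _ hq0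
  rw [neg_mul, h2, sub_neg_eq_add, mul_add, mul_inv_cancel₀ h3]
  ring

lemma stepWeight_two {q : ℂ} (hq0 : q ≠ 0) (i s : ℕ) :
    stepWeight q i 2 s = qPoch (-q) (q ^ 2) s * q ^ (s ^ 2) *
      (q ^ 2) ^ (if i ≤ 2 then s else 0) := by
  rw [stepWeight, if_pos rfl, ← pow_sq_mul_qPoch_reverse hq0]
  ring

lemma stepWeight_of_ne {r : ℕ} (hr : r ≠ 2) (q : ℂ) (i s : ℕ) :
    stepWeight q i r s = (q ^ 2) ^ (s ^ 2) * (q ^ 2) ^ (if i ≤ r then s else 0) := by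
  rw [stepWeight, if_neg hr, mul_one, pow_add]

lemma exists_norm_stepWeight_le {q : ℂ} (hq0 : q ≠ 0) (hq : ‖q‖ < 1) (i : ℕ) :
    ∃ C, 0 ≤ C ∧ ∀ r s, ‖stepWeight q i r s‖ ≤ C * ‖q‖ ^ s := by
  have hQ := norm_sq_lt_one hq
  obtain ⟨C, hC⟩ := exists_norm_qPoch_le (-q) hQ
  have hC0 : 0 ≤ C := (norm_nonneg _).trans (hC 0)
  have h1 (e : ℕ) : ‖q ^ 2‖ ^ e ≤ 1 := pow_le_one₀ (norm_nonneg _) hQ.le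
  have h2 (s : ℕ) : ‖q‖ ^ (s ^ 2) ≤ ‖q‖ ^ s :=
    pow_le_pow_of_le_one (norm_nonneg q) hq.le (Nat.le_self_pow two_ne_zero s)
  have h3 (s : ℕ) : ‖q ^ 2‖ ^ (s ^ 2) ≤ ‖q‖ ^ s := by
    rw [norm_pow, ← pow_mul]
    refine pow_le_pow_of_le_one (norm_nonneg q) hq.le ?_
    nlinarith [Nat.le_self_pow two_ne_zero s]
  refine ⟨C + 1, by linarith, fun r s => ?_⟩
  have h4 : 0 ≤ ‖q‖ ^ s := by positivity
  by_cases hr : r = 2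
  · subst hr
    rw [stepWeight_two hq0, norm_mul, norm_mul, norm_pow q, norm_pow (q ^ 2)]
    calc _ ≤ C * ‖q‖ ^ s * 1 := mul_le_mul (mul_le_mul (hC s) (h2 s) (by positivity) hC0) (h1 _)
          (by positivity) (by positivity)
      _ ≤ _ := by linarith
  · rw [stepWeight_of_ne hr, norm_mul, norm_pow (q ^ 2), norm_pow (q ^ 2)]
    calc _ ≤ ‖q‖ ^ s * 1 := mul_le_mul (h3 s) (h1 _) (by positivity) h4
      _ ≤ _ := by nlinarith

lemma summable_prod_pow {x : ℝ} (hx0 : 0 ≤ x) (hx : x < 1) (m : ℕ) :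
    Summable fun N : Fin m → ℕ => ∏ t, x ^ N t := by
  induction m with
  | zero => exact Summable.of_finite
  | succ m ih =>
    rw [← (Fin.consEquiv fun _ : Fin (m + 1) => ℕ).summable_iff]
    refine ((summable_geometric_of_lt_one hx0 hx).mul_of_nonneg ih (fun _ => by positivity)
      (fun _ => Finset.prod_nonneg fun _ _ => by positivity)).congr fun p => ?_
    simp [Fin.consEquiv, Fin.prod_univ_succ]

/-- A summable family over tuples can be summed over the first entry last. -/
lemma hasSum_of_hasSum_cons {m : ℕ} {f : (Fin (m + 1) → ℕ) → ℂ} {g : ℕ → ℂ} {a : ℂ}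
    (hf : Summable f) (hg : ∀ s, HasSum (fun N : Fin m → ℕ => f (Fin.cons s N)) (g s))
    (ha : HasSum g a) : HasSum f a := by
  have h1 := ((Fin.consEquiv fun _ : Fin (m + 1) => ℕ).hasSum_iff).2 hf.hasSum
  have h2 : HasSum g (∑' N, f N) := h1.prod_fiberwise hg
  rw [ha.unique h2]
  exact hf.hasSum

lemma exists_norm_tailTerm_le {q : ℂ} (hq0 : q ≠ 0) (hq : ‖q‖ < 1) (i : ℕ) {b : ℕ → ℂ} {Cb : ℝ}
    (hb : ∀ n, ‖b n‖ ≤ Cb) (m : ℕ) :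
    ∃ C, 0 ≤ C ∧ ∀ r n (N : Fin m → ℕ),
      ‖tailTerm q i b m r (Fin.cons n N)‖ ≤ C * ∏ t, ‖q‖ ^ N t := by
  obtain ⟨C₁, hC₁0, hC₁⟩ := exists_norm_stepWeight_le hq0 hq i
  obtain ⟨C₂, hC₂0, hC₂⟩ := exists_norm_invPoch_le (norm_sq_lt_one hq)
  induction m with
  | zero =>
    refine ⟨Cb, (norm_nonneg _).trans (hb 0), fun r n N => ?_⟩
    simpa [tailTerm_zero] using hb n
  | succ m ih =>
    obtain ⟨C, hC0, hC⟩ := ih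
    refine ⟨C₁ * C₂ * C, by positivity, fun r n N => ?_⟩
    obtain ⟨s, N, rfl⟩ : ∃ s N', N = Fin.cons s N' := ⟨N 0, Fin.tail N, (Fin.cons_self_tail N).symm⟩
    rw [tailTerm_cons_cons, norm_mul, norm_mul, Fin.prod_univ_succ]
    simp only [Fin.cons_zero, Fin.cons_succ]
    calc _ ≤ (C₁ * ‖q‖ ^ s) * C₂ * (C * ∏ t, ‖q‖ ^ N t) := by
          gcongr
          · exact hC₁ _ _
          · exact hC₂ _
          · exact hC _ _ _
      _ = _ := by ring

lemma summable_tailTerm_cons {q : ℂ} (hq0 : q ≠ 0) (hq : ‖q‖ < 1) (i : ℕ) {b : ℕ → ℂ} {Cb : ℝ}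
    (hb : ∀ n, ‖b n‖ ≤ Cb) (m r n : ℕ) :
    Summable fun N : Fin m → ℕ => tailTerm q i b m r (Fin.cons n N) := by
  obtain ⟨C, -, hC⟩ := exists_norm_tailTerm_le hq0 hq i hb m
  exact Summable.of_norm_bounded ((summable_prod_pow (norm_nonneg q) hq m).mul_left C) (hC r n)

/-- The signed power `(-1)^l q^{E l}` of a quadratic exponent. -/
noncomputable def signedPow (q : ℂ) (E : ℤ → ℤ) (l : ℤ) : ℂ := (-1) ^ l * q ^ E l

lemma signedPow_mul_zpow {q : ℂ} (hq0 : q ≠ 0) {E F G : ℤ → ℤ} (h : ∀ l, E l + F l = G l) :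
    (fun l => signedPow q E l * q ^ F l) = signedPow q G := by
  funext l
  rw [signedPow, signedPow, ← h, zpow_add₀ hq0]
  ring

lemma signedPow_antisymm {q : ℂ} {E : ℤ → ℤ} (h : ∀ l, E (-1 - l) = E l) (l : ℤ) :
    signedPow q E (-1 - l) = -signedPow q E l := by
  rw [signedPow, signedPow, h, neg_one_zpow_reflect, neg_mul]

lemma signedPow_mul_antisymm {q : ℂ} (hq0 : q ≠ 0) {E : ℤ → ℤ}
    (h : ∀ l, E (-1 - l) + 2 * (-1 - l) = E l + 2 * l) (l : ℤ) :
    signedPow q E (-1 - l) * (q ^ 2) ^ (-1 - l) = -(signedPow q E l * (q ^ 2) ^ l) := by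
  have e (l : ℤ) : signedPow q E l * (q ^ 2) ^ l = signedPow q (fun l => E l + 2 * l) l := by
    rw [signedPow, signedPow, zpow_add₀ hq0, zpow_mul]
    norm_cast
    ring
  rw [e, e, signedPow_antisymm h]

lemma neg_one_zpow_neg (l : ℤ) : (-1 : ℂ) ^ (-l) = (-1) ^ l := by
  rcases Int.even_or_odd l with h | h
  · simp [h.neg_one_zpow, h.neg.neg_one_zpow]
  · simp [h.neg_one_zpow, h.neg.neg_one_zpow]

lemma sq_zpow (q : ℂ) (l : ℤ) : (q ^ 2) ^ l = q ^ (2 * l) := by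
  rw [zpow_mul]
  norm_cast

/-- The unit Bailey pair in base `q ^ 2`. -/
lemma bilat_signedPow_unit {q : ℂ} (hq0 : q ≠ 0) (hq : ‖q‖ < 1) (n : ℕ) :
    bilat (q ^ 2) n n (signedPow q fun l => l ^ 2 - l) = if n = 0 then 1 else 0 := by
  refine bilat_unit (pow_ne_zero 2 hq0) (norm_sq_lt_one hq) (by simp [signedPow]) (fun l => ?_)
    (signedPow_mul_antisymm hq0 fun l => by ring) n
  rw [signedPow, signedPow, neg_one_zpow_neg, sq_zpow, mul_assoc, ← zpow_add₀ hq0]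
  congr 2
  ring

/-- The factor of the summand contributed by the last variable. -/
noncomputable def lastFactor (q : ℂ) (j n : ℕ) : ℂ :=
  (qPoch (q ^ (4 - 2 * j)) (q ^ (4 - 2 * j)) n)⁻¹

/-- The Bailey pair relative to `Q = q ^ 2` from which the iteration starts. -/
lemma bilat_succ_eq_lastFactor {q : ℂ} (hq0 : q ≠ 0) (hq : ‖q‖ < 1) {j : ℕ} (hj : j = 0 ∨ j = 1)
    (n : ℕ) : bilat (q ^ 2) n (n + 1) (signedPow q fun l => j * (l ^ 2 + l) + 2 * l ^ 2) =
      lastFactor q j n := by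
  have hQ0 := pow_ne_zero 2 hq0
  have hQ := norm_sq_lt_one hq
  rcases hj with rfl | rfl
  · have hanti := signedPow_mul_antisymm hq0
      (E := fun l => ((0 : ℕ) : ℤ) * (l ^ 2 + l) + 2 * l ^ 2) (fun l => by ring)
    rw [← bilat_eq_bilat_succ hQ0 hQ n hanti, bilat_square hQ0 hQ (by simp [signedPow]) ?_ hanti,
      lastFactor, ← pow_mul]
    intro l
    rw [signedPow, signedPow, neg_one_zpow_neg]
    congr 2
    ring
  · have h := hasSum_step_sq_add hQ0 hQ (signedPow q fun l => l ^ 2 - l) n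
    simp only [← bilat_eq_bilat_succ hQ0 hQ _ (signedPow_mul_antisymm hq0
      (E := fun l => l ^ 2 - l) fun l => by ring), bilat_signedPow_unit hq0 hq, sq_zpow] at h
    rw [signedPow_mul_zpow hq0 (G := fun l => ((1 : ℕ) : ℤ) * (l ^ 2 + l) + 2 * l ^ 2)
      fun l => by push_cast; ring] at h
    refine h.unique ?_
    convert hasSum_single (0 : ℕ) fun s hs => ?_ using 1
    · simp [lastFactor, invPoch_natCast]
    · simp [hs]

/-- The Bailey pair relative to `1` from which the iteration starts. -/
lemma bilat_eq_lastFactor {q : ℂ} (hq0 : q ≠ 0) (hq : ‖q‖ < 1) {j : ℕ} (hj : j = 0 ∨ j = 1)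
    (n : ℕ) : bilat (q ^ 2) n n (signedPow q fun l => j * (l ^ 2 + l) + 2 * l ^ 2) =
      lastFactor q j n := by
  rw [← bilat_succ_eq_lastFactor hq0 hq hj, bilat_eq_bilat_succ (pow_ne_zero 2 hq0)
    (norm_sq_lt_one hq) n (signedPow_mul_antisymm hq0 fun l => by ring)]

lemma exists_norm_lastFactor_le {q : ℂ} (hq : ‖q‖ < 1) {j : ℕ} (hj : j = 0 ∨ j = 1) :
    ∃ C, ∀ n, ‖lastFactor q j n‖ ≤ C := by
  have h : ‖q ^ (4 - 2 * j)‖ < 1 := by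
    rw [norm_pow]
    exact pow_lt_one₀ (norm_nonneg q) hq (by omega)
  exact exists_norm_inv_qPoch_le h h

/-- The inner sums all of whose variables occur in the linear part of the exponent: they form a
Bailey chain relative to `q ^ 2`. -/
lemma hasSum_tailTerm_of_le {q : ℂ} (hq0 : q ≠ 0) (hq : ‖q‖ < 1) {i j : ℕ} (hj : j = 0 ∨ j = 1)
    (m : ℕ) {r : ℕ} (hr : 2 ≤ r) (hir : i ≤ r) (n : ℕ) :
    HasSum (fun N : Fin m → ℕ => tailTerm q i (lastFactor q j) m r (Fin.cons n N))
      (bilat (q ^ 2) n (n + 1) (signedPow q fun l =>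
        j * (l ^ 2 + l) - 2 * l + 2 * (m + 1) * (l ^ 2 + l))) := by
  have hQ0 := pow_ne_zero 2 hq0
  have hQ := norm_sq_lt_one hq
  obtain ⟨Cb, hb⟩ := exists_norm_lastFactor_le hq hj
  induction m generalizing r n with
  | zero =>
    have h := bilat_succ_eq_lastFactor hq0 hq hj n
    have hE : (fun l : ℤ => (j : ℤ) * (l ^ 2 + l) - 2 * l + 2 * (((0 : ℕ) : ℤ) + 1) * (l ^ 2 + l)) =
        fun l : ℤ => (j : ℤ) * (l ^ 2 + l) + 2 * l ^ 2 := by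
      funext l
      push_cast
      ring
    simp only [tailTerm_zero, Fin.cons_zero]
    rw [hE, h]
    exact hasSum_unique fun _ : Fin 0 → ℕ => lastFactor q j n
  | succ m ih =>
    have h := hasSum_step_sq_add hQ0 hQ (signedPow q fun l =>
        j * (l ^ 2 + l) - 2 * l + 2 * (m + 1) * (l ^ 2 + l)) n
    simp only [sq_zpow] at h
    rw [signedPow_mul_zpow hq0 (G := fun l => j * (l ^ 2 + l) - 2 * l +
      2 * (((m + 1 : ℕ) : ℤ) + 1) * (l ^ 2 + l)) fun l => by push_cast; ring] at h
    refine hasSum_of_hasSum_cons (summable_tailTerm_cons hq0 hq i hb _ r n) (fun s => ?_) h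
    simp only [tailTerm_cons_cons]
    rw [stepWeight_of_ne (by omega), if_pos (by omega), ← pow_add]
    exact (ih (by omega) (by omega) s).mul_left _

/-- The inner sums as Bailey pairs relative to `1`; the factor `Q ^ n` is present exactly when the
variable `N_r = n` occurs in the linear part of the exponent. Here `d = k - i` and `e = i - r`. -/
lemma hasSum_pow_mul_tailTerm {q : ℂ} (hq0 : q ≠ 0) (hq : ‖q‖ < 1) {j : ℕ} (hj : j = 0 ∨ j = 1)
    (i d e m : ℕ) (hm : m + 1 = d + e) {r : ℕ} (hr : 2 ≤ r) (hi : i = r + e) (n : ℕ) :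
    HasSum (fun N : Fin m → ℕ => (q ^ 2) ^ (if i ≤ r then n else 0) *
        tailTerm q i (lastFactor q j) m r (Fin.cons n N))
      (bilat (q ^ 2) n n (signedPow q fun l =>
        j * (l ^ 2 + l) + 2 * d * (l ^ 2 + l) + 2 * e * l ^ 2)) := by
  have hQ0 := pow_ne_zero 2 hq0
  have hQ := norm_sq_lt_one hq
  obtain ⟨Cb, hb⟩ := exists_norm_lastFactor_le hq hj
  induction e generalizing m r n with
  | zero =>
    have h := hasSum_tailTerm_of_le hq0 hq (i := i) hj m hr (by omega) n
    have h1 := zpow_mul_bilat hQ0 hQ n (signedPow_antisymm (q := q)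
      (E := fun l => j * (l ^ 2 + l) + 2 * d * (l ^ 2 + l) + 2 * ((0 : ℕ) : ℤ) * l ^ 2)
      fun l => by push_cast; ring)
    simp only [sq_zpow _ (-_)] at h1
    rw [signedPow_mul_zpow hq0 (G := fun l => j * (l ^ 2 + l) - 2 * l +
      2 * (m + 1) * (l ^ 2 + l)), zpow_natCast] at h1
    · rw [← h1, if_pos (by omega)]
      exact h.mul_left _
    · intro l
      rw [show (m : ℤ) + 1 = d by exact_mod_cast hm]
      push_cast
      ring
  | succ e ih =>
    simp only [if_neg (show ¬ i ≤ r by omega), pow_zero, one_mul]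
    cases m with
    | zero =>
      obtain ⟨rfl, rfl⟩ : d = 0 ∧ e = 0 := by omega
      have h := bilat_eq_lastFactor hq0 hq hj n
      have hE : (fun l : ℤ => (j : ℤ) * (l ^ 2 + l) + 2 * ((0 : ℕ) : ℤ) * (l ^ 2 + l) +
          2 * ((0 + 1 : ℕ) : ℤ) * l ^ 2) =
          fun l : ℤ => (j : ℤ) * (l ^ 2 + l) + 2 * l ^ 2 := by
        funext l
        push_cast
        ring
      simp only [tailTerm_zero, Fin.cons_zero]
      rw [hE, h]
      exact hasSum_unique fun _ : Fin 0 → ℕ => lastFactor q j n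
    | succ m =>
      have h := hasSum_step_sq hQ0 hQ (signedPow q fun l =>
        j * (l ^ 2 + l) + 2 * d * (l ^ 2 + l) + 2 * e * l ^ 2) n
      simp only [sq_zpow] at h
      rw [signedPow_mul_zpow hq0 (G := fun l => j * (l ^ 2 + l) + 2 * d * (l ^ 2 + l) +
        2 * ((e + 1 : ℕ) : ℤ) * l ^ 2) fun l => by push_cast; ring] at h
      refine hasSum_of_hasSum_cons (summable_tailTerm_cons hq0 hq i hb _ r n) (fun s => ?_) h
      simp only [tailTerm_cons_cons]
      rw [stepWeight_of_ne (by omega)]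
      refine ((ih m (by omega) (r := r + 1) (by omega) (by omega) s).mul_left
        ((q ^ 2) ^ (s ^ 2) * invPoch (q ^ 2) ((n : ℤ) - s))).congr_fun fun N => ?_
      ring

/-- The sum over all variables but `N_1 = n`, for `i = 2 + e` and `k = i + d = m + 2`. -/
lemma hasSum_tailTerm_one {q : ℂ} (hq0 : q ≠ 0) (hq : ‖q‖ < 1) {j : ℕ} (hj : j = 0 ∨ j = 1)
    (d e m : ℕ) (hm : m = d + e) (hjm : m = 0 → j = 1) (n : ℕ) :
    HasSum (fun N : Fin m → ℕ => tailTerm q (2 + e) (lastFactor q j) m 1 (Fin.cons n N))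
      (qPoch (-q) (q ^ 2) n * bilat (q ^ 2) n n (signedPow q fun l =>
        j * (l ^ 2 + l) + 2 * d * (l ^ 2 + l) + (2 * e + 1) * l ^ 2)) := by
  have hQ := norm_sq_lt_one hq
  obtain ⟨Cb, hb⟩ := exists_norm_lastFactor_le hq hj
  have h := hasSum_step_special hq0 hQ (signedPow q fun l =>
    j * (l ^ 2 + l) + 2 * d * (l ^ 2 + l) + 2 * e * l ^ 2) n
  rw [signedPow_mul_zpow hq0 (G := fun l => j * (l ^ 2 + l) + 2 * d * (l ^ 2 + l) +
    (2 * e + 1) * l ^ 2) fun l => by ring] at h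
  cases m with
  | zero =>
    -- With a single variable there is no `N_2`; the step is applied to the unit Bailey pair
    -- instead. This is where `j = 1` is needed.
    obtain rfl := hjm rfl
    obtain ⟨rfl, rfl⟩ : d = 0 ∧ e = 0 := by omega
    have hunit (s : ℕ) : bilat (q ^ 2) s s (signedPow q fun l => ((1 : ℕ) : ℤ) * (l ^ 2 + l) +
        2 * ((0 : ℕ) : ℤ) * (l ^ 2 + l) + 2 * ((0 : ℕ) : ℤ) * l ^ 2) = if s = 0 then 1 else 0 := by
      rw [← bilat_signedPow_unit hq0 hq s, ← bilat_neg]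
      congr 1
      funext l
      rw [signedPow, signedPow, neg_one_zpow_neg]
      congr 2
      push_cast
      ring
    simp only [hunit] at h
    have h0 : HasSum (fun s : ℕ => qPoch (-q) (q ^ 2) s * q ^ (s ^ 2) *
        invPoch (q ^ 2) ((n : ℤ) - s) * if s = 0 then 1 else 0) (lastFactor q 1 n) := by
      convert hasSum_single (0 : ℕ) fun s hs => ?_ using 1
      · simp [lastFactor, invPoch_natCast, qPoch]
      · simp [hs]
    simp only [tailTerm_zero, Fin.cons_zero]
    rw [h.unique h0]
    exact hasSum_unique fun _ : Fin 0 → ℕ => lastFactor q 1 n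
  | succ m =>
    refine hasSum_of_hasSum_cons (summable_tailTerm_cons hq0 hq _ hb _ 1 n) (fun s => ?_) h
    simp only [tailTerm_cons_cons]
    rw [stepWeight_two hq0]
    refine ((hasSum_pow_mul_tailTerm hq0 hq hj (2 + e) d e m hm le_rfl rfl s).mul_left
      (qPoch (-q) (q ^ 2) s * q ^ (s ^ 2) * invPoch (q ^ 2) ((n : ℤ) - s))).congr_fun fun N => ?_
    ring

/-- The summand of the multiple series, extended by zero to all tuples. -/
noncomputable def extendedSummand (q : ℂ) (i j m : ℕ) (N : Fin (m + 1) → ℕ) : ℂ :=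
  (q ^ 2) ^ (N 0 ^ 2) * qPochInf (-q ^ (1 + 2 * N 0)) (q ^ 2) *
    tailTerm q i (lastFactor q j) m 1 N

lemma neg_mul_sq_pow (q : ℂ) (n : ℕ) : -q * (q ^ 2) ^ n = -q ^ (1 + 2 * n) := by
  rw [← pow_mul]
  ring

lemma qPoch_mul_qPochInf_neg {q : ℂ} (hq : ‖q‖ < 1) (n : ℕ) :
    qPoch (-q) (q ^ 2) n * qPochInf (-q ^ (1 + 2 * n)) (q ^ 2) = qPochInf (-q) (q ^ 2) := by
  rw [← qPoch_mul_qPochInf (-q) (norm_sq_lt_one hq) n, neg_mul_sq_pow]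

lemma summable_extendedSummand {q : ℂ} (hq0 : q ≠ 0) (hq : ‖q‖ < 1) (i : ℕ) {j : ℕ}
    (hj : j = 0 ∨ j = 1) (m : ℕ) : Summable (extendedSummand q i j m) := by
  have hQ := norm_sq_lt_one hq
  obtain ⟨Cb, hb⟩ := exists_norm_lastFactor_le hq hj
  obtain ⟨C, hC0, hC⟩ := exists_norm_tailTerm_le hq0 hq i hb m
  obtain ⟨D, hD⟩ := exists_norm_inv_qPoch_le (a := -q) (by rwa [norm_neg]) hQ
  have hD0 : 0 ≤ D := (norm_nonneg _).trans (hD 0)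
  have hinf (n : ℕ) : ‖qPochInf (-q ^ (1 + 2 * n)) (q ^ 2)‖ ≤
      D * ‖qPochInf (-q) (q ^ 2)‖ := by
    have h0 := qPoch_ne_zero_of_norm_lt (a := -q) (by rwa [norm_neg]) hQ n
    rw [← qPoch_mul_qPochInf_neg hq n, ← one_mul ‖qPochInf (-q ^ (1 + 2 * n)) (q ^ 2)‖, norm_mul,
      ← mul_assoc, ← norm_one (α := ℂ), ← inv_mul_cancel₀ h0, norm_mul]
    gcongr
    exact hD n
  refine Summable.of_norm_bounded ((summable_prod_pow (norm_nonneg q) hq (m + 1)).mul_left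
    (D * ‖qPochInf (-q) (q ^ 2)‖ * C)) fun N => ?_
  obtain ⟨s, N, rfl⟩ : ∃ s N', N = Fin.cons s N' := ⟨N 0, Fin.tail N, (Fin.cons_self_tail N).symm⟩
  have h1 : ‖(q ^ 2) ^ (s ^ 2)‖ ≤ ‖q‖ ^ s := by
    rw [norm_pow, norm_pow, ← pow_mul]
    refine pow_le_pow_of_le_one (norm_nonneg q) hq.le ?_
    nlinarith [Nat.le_self_pow two_ne_zero s]
  rw [extendedSummand, norm_mul, norm_mul, Fin.prod_univ_succ]
  simp only [Fin.cons_zero, Fin.cons_succ]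
  calc _ ≤ ‖q‖ ^ s * (D * ‖qPochInf (-q) (q ^ 2)‖) * (C * ∏ t, ‖q‖ ^ N t) :=
        mul_le_mul (mul_le_mul h1 (hinf s) (norm_nonneg _) (by positivity)) (hC 1 s N)
          (norm_nonneg _) (by positivity)
    _ = _ := by ring

/-- The multiple series as a theta series, for `i = 2 + e` and `k = i + d = m + 2`. -/
lemma hasSum_extendedSummand {q : ℂ} (hq0 : q ≠ 0) (hq : ‖q‖ < 1) {j : ℕ} (hj : j = 0 ∨ j = 1)
    (d e m : ℕ) (hm : m = d + e) (hjm : m = 0 → j = 1) :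
    HasSum (extendedSummand q (2 + e) j m)
      (qPochInf (-q) (q ^ 2) * ((∑' l : ℤ, signedPow q (fun l =>
        (2 * m + 3 + j) * l ^ 2 + (2 * d + j) * l) l) * (qPochInf (q ^ 2) (q ^ 2))⁻¹)) := by
  have hQ0 := pow_ne_zero 2 hq0
  have hQ := norm_sq_lt_one hq
  have hsum := summable_extendedSummand hq0 hq (2 + e) hj m
  have hnorm {A : ℤ} (hA : 0 < A) (B : ℤ) :
      Summable fun l => ‖signedPow q (fun l => A * l ^ 2 + B * l) l‖ := by
    refine (summable_norm_zpow_quadratic hq0 hq hA B).congr fun l => ?_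
    rw [signedPow, norm_mul, norm_zpow (-1 : ℂ), norm_neg, norm_one, one_zpow, one_mul]
  have hfib (s : ℕ) := (hasSum_tailTerm_one hq0 hq hj d e m hm hjm s).mul_left
    ((q ^ 2) ^ (s ^ 2) * qPochInf (-q ^ (1 + 2 * s)) (q ^ 2))
  have hE : (fun l : ℤ => (j : ℤ) * (l ^ 2 + l) + 2 * d * (l ^ 2 + l) + (2 * e + 1) * l ^ 2) =
      fun l : ℤ => (2 * m + 1 + j : ℤ) * l ^ 2 + (2 * d + j) * l := by
    funext l
    rw [hm]
    push_cast
    ring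
  have hG := signedPow_mul_zpow (q := q) hq0
    (E := fun l => (2 * m + 1 + j) * l ^ 2 + (2 * d + j) * l) (F := fun l => 2 * l ^ 2)
    (G := fun l => (2 * m + 3 + j) * l ^ 2 + (2 * d + j) * l) fun l => by ring
  simp only [← sq_zpow] at hG
  have hlast := tsum_sq_mul_bilat hQ0 hQ
    (hnorm (by positivity : (0 : ℤ) < 2 * m + 1 + j) (2 * d + j))
    ((hnorm (by positivity : (0 : ℤ) < 2 * m + 3 + j) (2 * d + j)).congr fun l => by
      rw [← congrFun hG l])
  rw [hG] at hlast
  have hg (s : ℕ) : (q ^ 2) ^ (s ^ 2) * qPochInf (-q ^ (1 + 2 * s)) (q ^ 2) *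
      (qPoch (-q) (q ^ 2) s * bilat (q ^ 2) s s (signedPow q fun l =>
        j * (l ^ 2 + l) + 2 * d * (l ^ 2 + l) + (2 * e + 1) * l ^ 2)) =
      qPochInf (-q) (q ^ 2) * ((q ^ 2) ^ (s ^ 2) * bilat (q ^ 2) s s (signedPow q fun l =>
        (2 * m + 1 + j) * l ^ 2 + (2 * d + j) * l)) := by
    rw [hE, ← qPoch_mul_qPochInf_neg hq s]
    ring
  have hcons := ((Fin.consEquiv fun _ : Fin (m + 1) => ℕ).hasSum_iff).2 hsum.hasSum
  have htot := hcons.prod_fiberwise hfib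
  simp only [hg] at htot
  rw [← hlast, ← tsum_mul_left, htot.tsum_eq]
  exact hsum.hasSum

/-! ### The product side -/

/-- The theta series as an infinite product, in the parameters of the statement. -/
lemma tsum_signedPow_eq_qPochInf₃ {q : ℂ} (hq0 : q ≠ 0) (hq : ‖q‖ < 1) {A B : ℕ} (hBA : B < A) :
    ∑' l : ℤ, signedPow q (fun l => A * l ^ 2 + B * l) l =
      qPochInf₃ (q ^ (2 * A)) (q ^ (A - B)) (q ^ (A + B)) (q ^ (2 * A)) := by
  have hA : 0 < A := by omega
  have hQ : ‖q ^ (2 * A)‖ < 1 := by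
    rw [norm_pow]
    exact pow_lt_one₀ (norm_nonneg q) hq (by omega)
  have hs : Summable fun l => ‖signedPow q (fun l => A * l ^ 2 + B * l) l‖ := by
    refine (summable_norm_zpow_quadratic hq0 hq (A := A) (by exact_mod_cast hA) B).congr
      fun l => ?_
    rw [signedPow, norm_mul, norm_zpow (-1 : ℂ), norm_neg, norm_one, one_zpow, one_mul]
  rw [tsum_eq_qPochInf_mul (pow_ne_zero (2 * A) hq0) hQ (pow_ne_zero (A + B) hq0)
    (by simp [signedPow]) (fun l => ?_) hs, qPochInf₃,
    show 2 * A = (A - B) + (A + B) by omega, pow_add,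
    mul_div_cancel_right₀ _ (pow_ne_zero (A + B) hq0), mul_right_comm]
  have e : (A : ℤ) * (l + 1) ^ 2 + B * (l + 1) =
      ((A + B : ℕ) : ℤ) + ((2 * A : ℕ) : ℤ) * l + (A * l ^ 2 + B * l) := by
    push_cast
    ring
  rw [signedPow, signedPow, e, zpow_add₀ hq0, zpow_add₀ hq0, zpow_mul q, zpow_natCast,
    zpow_natCast, zpow_add₀ (by norm_num : (-1 : ℂ) ≠ 0), zpow_one]
  ring

/-- The factors `(-q; q²)_∞` and `1 / (q²; q²)_∞` left by the last step combine to the remaining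
factors of the product side. -/
lemma qPochInf_neg_div_eq {q : ℂ} (hq : ‖q‖ < 1) :
    qPochInf (-q) (q ^ 2) / qPochInf (q ^ 2) (q ^ 2) = qPochInf (q ^ 2) (q ^ 4) / qPochInf q q := by
  have hQ := norm_sq_lt_one hq
  have h1 := qPochInf_mul_qPochInf_mul_self q hq
  have h2 := qPochInf_mul_qPochInf_neg q hQ
  rw [← pow_mul] at h2
  rw [← pow_two] at h1
  rw [div_eq_div_iff (qPochInf_ne_zero_of_norm_lt hQ hQ) (qPochInf_ne_zero_of_norm_lt hq hq),
    ← h1, ← h2]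
  ring

/-! ### Comparison of the summands -/

lemma Chain.entry_succ {m : ℕ} (N : Chain (m + 2)) {t : ℕ} (ht : t < m + 1) :
    N.entry (t + 1) = N.1 ⟨t, ht⟩ := by
  rw [Chain.entry, dif_pos ⟨by omega, by omega⟩]
  rfl

lemma Chain.entry_succ_le {m : ℕ} (N : Chain (m + 2)) {t : ℕ} (ht : t < m) :
    N.entry (t + 2) ≤ N.entry (t + 1) := by
  rw [N.entry_succ (show t + 1 < m + 1 by omega), N.entry_succ (show t < m + 1 by omega)]
  exact N.2 (by simp)

lemma sum_Icc_one_eq (f : ℕ → ℕ) (m : ℕ) :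
    ∑ r ∈ Finset.Icc 1 m, f r = ∑ t ∈ Finset.range m, f (t + 1) := by
  rw [← Finset.Ico_add_one_right_eq_Icc, Finset.sum_Ico_eq_sum_range]
  simp [add_comm]

lemma prod_Icc_one_eq (f : ℕ → ℂ) (m : ℕ) :
    ∏ r ∈ Finset.Icc 1 m, f r = ∏ t ∈ Finset.range m, f (t + 1) := by
  rw [← Finset.Ico_add_one_right_eq_Icc, Finset.prod_Ico_eq_prod_range]
  simp [add_comm]

lemma expo_eq {m i : ℕ} (hi : 2 ≤ i) (N : Chain (m + 2)) :
    expo (m + 2) i N = 2 * (N.entry 1 ^ 2 + ∑ t ∈ Finset.range m,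
      (N.entry (t + 2) ^ 2 + if i ≤ t + 2 then N.entry (t + 2) else 0)) := by
  have h1 : ∑ r ∈ Finset.Icc i (m + 1), N.entry r =
      ∑ r ∈ Finset.Icc 1 (m + 1), if i ≤ r then N.entry r else 0 := by
    rw [← Finset.sum_filter]
    congr 1
    ext r
    simp only [Finset.mem_Icc, Finset.mem_filter]
    omega
  rw [expo, show m + 2 - 1 = m + 1 by omega, h1, sum_Icc_one_eq, sum_Icc_one_eq,
    Finset.sum_range_succ', Finset.sum_range_succ', Finset.sum_add_distrib,
    if_neg (show ¬ i ≤ 0 + 1 by omega)]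
  simp only [add_assoc, Nat.reduceAdd]
  ring

lemma prod_stepWeight (q : ℂ) (i : ℕ) {m : ℕ} (N : Chain (m + 2)) :
    ∏ t ∈ Finset.range m, stepWeight q i (t + 2) (N.entry (t + 2)) =
      (q ^ 2) ^ (∑ t ∈ Finset.range m,
        (N.entry (t + 2) ^ 2 + if i ≤ t + 2 then N.entry (t + 2) else 0)) *
      qPoch (-q ^ (1 - 2 * (N.entry 2 : ℤ))) (q ^ 2) (N.entry 2) := by
  simp only [stepWeight, Finset.prod_mul_distrib, Finset.prod_pow_eq_pow_sum]
  congr 1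
  cases m with
  | zero =>
    -- A single variable: here `N_2` is read as `0`.
    have h : N.entry 2 = 0 := by simp [Chain.entry]
    simp [h, qPoch]
  | succ m =>
    rw [Finset.prod_range_succ', Finset.prod_eq_one fun t _ => by simp]
    simp

lemma summand_eq_extendedSummand (q : ℂ) {m i : ℕ} (hi : 2 ≤ i) (j : ℕ) (N : Chain (m + 2)) :
    summand (m + 2) i j q N = extendedSummand q i j m N.1 := by
  have h1 : N.1 (0 : Fin (m + 1)) = N.entry 1 := (N.entry_succ (show 0 < m + 1 by omega)).symm
  have h2 : tailTerm q i (lastFactor q j) m 1 N.1 =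
      (∏ t ∈ Finset.range m, stepWeight q i (t + 2) (N.entry (t + 2)) *
        (qPoch (q ^ 2) (q ^ 2) (N.entry (t + 1) - N.entry (t + 2)))⁻¹) *
        lastFactor q j (N.entry (m + 1)) := by
    rw [tailTerm, N.entry_succ (show m < m + 1 by omega), Finset.prod_range]
    congr 1
    refine Finset.prod_congr rfl fun t _ => ?_
    have e1 : N.1 t.succ = N.entry (t + 2) :=
      (N.entry_succ (show (t : ℕ) + 1 < m + 1 by omega)).symm
    have e2 : N.1 t.castSucc = N.entry (t + 1) :=
      (N.entry_succ (show (t : ℕ) < m + 1 by omega)).symm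
    rw [e1, e2, ← Nat.cast_sub (N.entry_succ_le t.2), invPoch_natCast,
      show 1 + 1 + (t : ℕ) = t + 2 by ring]
  rw [extendedSummand, h1, h2, Finset.prod_mul_distrib, prod_stepWeight, summand, expo_eq hi,
    denom, show m + 2 - 2 = m by omega, show m + 2 - 1 = m + 1 by omega, prod_Icc_one_eq,
    lastFactor, Finset.prod_inv_distrib, pow_mul, pow_add, div_eq_mul_inv, mul_inv]
  ring

lemma extendedSummand_eq_zero (q : ℂ) (i j : ℕ) {m : ℕ} {N : Fin (m + 1) → ℕ}
    (hN : ¬ Antitone N) : extendedSummand q i j m N = 0 := by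
  rw [Fin.antitone_iff_succ_le] at hN
  push Not at hN
  obtain ⟨t, ht⟩ := hN
  have h : invPoch (q ^ 2) ((N t.castSucc : ℤ) - N t.succ) = 0 :=
    invPoch_of_neg _ (by omega)
  rw [extendedSummand, tailTerm, Finset.prod_eq_zero (Finset.mem_univ t) (by rw [h, mul_zero])]
  ring

/-- Restriction of the sum over all tuples to the antitone ones. -/
lemma hasSum_chain {m i j : ℕ} {q a : ℂ} (hi : 2 ≤ i) (h : HasSum (extendedSummand q i j m) a) :
    HasSum (fun N : Chain (m + 2) => summand (m + 2) i j q N) a := by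
  have h1 := (hasSum_subtype_iff_of_support_subset (f := extendedSummand q i j m)
    (s := {N | Antitone N}) fun N hN => by
      by_contra hN'
      exact hN (extendedSummand_eq_zero q i j hN')).2 h
  have h2 : (fun N : Chain (m + 2) => summand (m + 2) i j q N) =
      fun N => extendedSummand q i j m N.1 :=
    funext fun N => summand_eq_extendedSummand q hi j N
  rw [h2]
  exact h1

/-! ### The degenerate base -/

lemma qPochInf_zero_left (Q : ℂ) : qPochInf 0 Q = 1 := by simp [qPochInf]

/-- For `q = 0` only the tuple `0` contributes. -/
lemma hasSum_summand_zero {m i j : ℕ} (hi : 2 ≤ i) :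
    HasSum (fun N : Chain (m + 2) => summand (m + 2) i j 0 N) 1 := by
  have hsingle : summand (m + 2) i j 0 ⟨0, antitone_const⟩ = 1 := by
    have h0 (r : ℕ) : Chain.entry (⟨0, antitone_const⟩ : Chain (m + 2)) r = 0 := by
      simp [Chain.entry]
    simp [summand, expo, denom, h0, qPoch, qPochInf]
  rw [← hsingle]
  refine hasSum_single _ fun N hN => ?_
  have hexpo : expo (m + 2) i N ≠ 0 := by
    intro h
    apply hN
    rw [expo_eq hi] at h
    have h1 : N.entry 1 = 0 := by
      have h2 : N.entry 1 ^ 2 = 0 := by omega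
      simpa using h2
    rw [N.entry_succ (show 0 < m + 1 by omega)] at h1
    refine Subtype.ext (funext fun t => ?_)
    have h3 : N.1 t ≤ N.1 ⟨0, by omega⟩ := N.2 (Fin.mk_le_of_le_val (Nat.zero_le _))
    exact Nat.le_zero.1 (h3.trans h1.le)
  rw [summand, zero_pow hexpo]
  ring

end GollnitzGordon

theorem theorem1p6 (k i j : ℕ) (hj : j = 0 ∨ j = 1) (hi : 2 ≤ i) (hik : i ≤ k)
    (hkj : (2 * (k : ℝ) + j) / 2 > 2) (q : ℂ) (hq : ‖q‖ < 1) :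
    HasSum (fun N : GollnitzGordon.Chain k => GollnitzGordon.summand k i j q N)
      (GollnitzGordon.qPochInf (q ^ 2) (q ^ 4) *
          GollnitzGordon.qPochInf₃ (q ^ (4 * k - 2 + 2 * j)) (q ^ (2 * i - 1))
            (q ^ (4 * k - 2 * i - 1 + 2 * j)) (q ^ (4 * k - 2 + 2 * j)) /
        GollnitzGordon.qPochInf q q) := by
  obtain ⟨m, rfl⟩ : ∃ m, k = m + 2 := ⟨k - 2, by omega⟩
  have hkj' : 4 < 2 * (m + 2) + j := by
    have h : (4 : ℝ) < 2 * ((m + 2 : ℕ) : ℝ) + j := by linarith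
    exact_mod_cast h
  rcases eq_or_ne q 0 with rfl | hq0
  · have h1 : 4 * (m + 2) - 2 + 2 * j ≠ 0 := by omega
    have h2 : 2 * i - 1 ≠ 0 := by omega
    have h3 : 4 * (m + 2) - 2 * i - 1 + 2 * j ≠ 0 := by omega
    rw [zero_pow h1, zero_pow h2, zero_pow h3, zero_pow two_ne_zero]
    simpa [GollnitzGordon.qPochInf₃, GollnitzGordon.qPochInf_zero_left] using
      GollnitzGordon.hasSum_summand_zero (m := m) hi
  · obtain ⟨e, rfl⟩ := Nat.exists_eq_add_of_le hi
    obtain ⟨d, hd⟩ : ∃ d, m = d + e := ⟨m - e, by omega⟩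
    have h := GollnitzGordon.hasSum_extendedSummand hq0 hq hj d e m hd (by omega)
    have ht := GollnitzGordon.tsum_signedPow_eq_qPochInf₃ hq0 hq
      (show 2 * d + j < 2 * m + 3 + j by omega)
    push_cast at ht
    rw [ht, show 2 * (2 * m + 3 + j) = 4 * (m + 2) - 2 + 2 * j by omega,
      show 2 * m + 3 + j - (2 * d + j) = 2 * (2 + e) - 1 by omega,
      show 2 * m + 3 + j + (2 * d + j) = 4 * (m + 2) - 2 * (2 + e) - 1 + 2 * j by omega,
      mul_left_comm, ← div_eq_mul_inv, GollnitzGordon.qPochInf_neg_div_eq hq, mul_div_assoc',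
      mul_comm (GollnitzGordon.qPochInf₃ _ _ _ _)] at h
    exact GollnitzGordon.hasSum_chain (by omega) h
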